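/- **Setting.** Let $\mathcal X$ be a measurable space, $\mathcal L$ a finite label set, $P_X$ a probability distribution on $\mathcal X$, and let $\eta,\hat\eta$ be measurable maps from $\mathcal X$ to the probability vectors on $\mathcal L$. Let $P=P_X\times\mathrm{Cat}(\eta(X))\times\mathrm{Cat}(\hat\eta(X))$ be the law of a triplet $(X,Y,Y')$ with $X\sim P_X$ and, given $X$, $Y\sim \mathrm{Cat}(\eta(X))$ and $Y'\sim\mathrm{Cat}(\hat\eta(X))$ independent. A distinguisher procedure $\hat D$ maps every data set $\mathcal D=(Z_1,\dots,Z_n)$ of triplets, for every $n$, to a score function $\hat g_{\mathcal D}:\mathcal X\times\mathcal L\to\mathbb R$, jointly measurably in the data and the argument. Put $$\phi(x,y;\mathcal D)=\mathbb E_{X',Y'}\,\mathbf 1\big(\hat g_{\mathcal D}(x,y)<\hat g_{\mathcal D}(X',Y')\big),\qquad \psi(x',y';\mathcal D)=\mathbb E_{X,Y}\,\mathbf 1\big(\hat g_{\mathcal D}(X,Y)<\hat g_{\mathcal D}(x',y')\big),$$ with $(X,Y)\sim P_X\times\mathrm{Cat}(\eta(X))$ and $(X',Y')\sim P_X\times \mathrm{Cat}(\hat\eta(X'))$.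 **Sampling and folds.** Fix an integer $K\ge 2$. Let $Z_i=(X_i,Y_i,Y_i')$, $i\ge1$, be iid with law $P$. For $n=Km$ let $\mathcal I_{n,1},\dots,\mathcal I_{n,K}$ be a (non-random) partition of $\{1,\dots,n\}$ into $K$ folds of equal size $n_k=m$, let $\mathcal D_{n,-k}$ be the data outside the $k$-th fold (in increasing index order; its size is $n_{tr}=(K-1)m$), and let $\hat g_{n,-k}=\hat g_{\mathcal D_{n,-k}}$. Let $$\sigma^2_{tr,cross}=\operatorname{Var}\Big(\mathbb E\big[\phi(X,Y;\mathcal D)+\psi(X,Y';\mathcal D)\,\big|\,X,Y,Y'\big]\Big),$$ where $(X,Y,Y')\sim P$ is independent of a data set $\mathcal D$ of $n_{tr}$ iid triplets with law $P$. This number depends on $n$ only through $n_{tr}$. With $$\hat\phi_k(u)=\frac1{n_k}\sum_{i\in\mathcal I_{n,k}}\mathbf 1\big(\hat g_{n,-k}(u)<\hat g_{n,-k}(X_i,Y_i')\big),\quad \hat\psi_k(v)=\frac1{n_k}\sum_{i\in\mathcal I_{n,k}}\mathbf 1\big(\hat g_{n,-k}(X_i,Y_i)<\hat g_{n,-k}(v)\big),$$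 $$T_{n,-k}=\frac1{n_k^2}\sum_{i,j\in\mathcal I_{n,k}}\mathbf 1\big(\hat g_{n,-k}(X_i,Y_i)<\hat g_{n,-k}(X_j,Y_j')\big),$$ define the variance estimator $$\hat\sigma^2_{tr,cross}=\frac1K\sum_{k=1}^K\frac1{n_k-1}\sum_{i\in\mathcal I_{n,k}}\Big(\hat\phi_k(X_i,Y_i)+\hat\psi_k(X_i,Y_i')-2T_{n,-k}\Big)^2 .$$ **Assumption.** Let $(X,Y)\sim P_X\times\mathrm{Cat}(\eta(X))$ and $(X',Y')\sim P_X\times\mathrm{Cat}(\hat\eta(X'))$. 1. There is $B>0$ such that for every $n\ge1$ and every fixed data set $\mathcal D$ of size $n$, the random variables $\hat g_{\mathcal D}(X,Y)$ and $\hat g_{\mathcal D}(X',Y')$ have Lebesgue densities bounded by $B$. 2. There is $\beta>0$ such that for all $n\ge2$ and all $1\le i\le n$, if $\mathcal D_n$ consists of $n$ iid triplets with law $P$ and $\mathcal D_n^i$ is $\mathcal D_n$ with its $i$-th triplet replaced by an iid copy, independent of the evaluation point, then for $W=\hat g_{\mathcal D_n}(X,Y)-\hat g_{\mathcal D_n^i}(X,Y)$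 and for $W=\hat g_{\mathcal D_n}(X',Y')-\hat g_{\mathcal D_n^i}(X',Y')$ (with the evaluation point independent of $\mathcal D_n$), $$\mathbb P(|W|\ge t)\le 2\exp\!\Big(-(t/\kappa_n)^{1/\beta}\Big)\quad\text{for all }t\ge0,\qquad \kappa_n=(\log n)^{-\beta}n^{-1/2}.$$ 3. There is $c>0$ such that $\sigma^2_{tr,cross}>c$ for every $n=Km$, $m\ge1$. **Proposition.** Under this assumption, as $m\to\infty$ (so $n=Km\to\infty$ with $K$ fixed), $$\frac{\hat\sigma^2_{tr,cross}}{\sigma^2_{tr,cross}}\xrightarrow{\;p\;}1 .$$ -/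

import Mathlib

open MeasureTheory ProbabilityTheory Filter
open scoped ENNReal NNReal

noncomputable section

namespace CrossFit

/-! ### Sampling model -/

/-- The categorical distribution `Cat(p)` on a finite label set. -/
def cat {L : Type*} [Fintype L] [MeasurableSpace L] (p : L → ℝ) : Measure L :=
  ∑ y, ENNReal.ofReal (p y) • Measure.dirac y

/-- A measurable map `x ↦ η(x)` from the feature space to the probability vectors on the finite
label set. -/
structure Classifier (X L : Type*) [MeasurableSpace X] [Fintype L] where
  prob : X → L → ℝ
  measurable_prob : Measurable prob
  mem_simplex : ∀ x, prob x ∈ stdSimplex ℝ L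

theorem cat_univ {L : Type*} [Fintype L] [MeasurableSpace L] {p : L → ℝ}
    (hp : p ∈ stdSimplex ℝ L) : cat p Set.univ = 1 := by
  simp only [cat, Measure.coe_finsetSum, Finset.sum_apply, Measure.smul_apply, measure_univ,
    smul_eq_mul, mul_one]
  rw [← ENNReal.ofReal_sum_of_nonneg (fun i _ => hp.1 i), hp.2, ENNReal.ofReal_one]

/-- The Markov kernel `x ↦ Cat(η(x))`. -/
def Classifier.kernel {X L : Type*} [MeasurableSpace X] [Fintype L] [MeasurableSpace L]
    (η : Classifier X L) : Kernel X L where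
  toFun x := cat (η.prob x)
  measurable' := by
    refine Measure.measurable_of_measurable_coe _ fun s _ => ?_
    simp only [cat, Measure.coe_finsetSum, Finset.sum_apply, Measure.smul_apply, smul_eq_mul]
    refine Finset.measurable_sum _ fun y _ => Measurable.mul_const ?_ _
    exact ENNReal.measurable_ofReal.comp ((measurable_pi_apply y).comp η.measurable_prob)

instance {X L : Type*} [MeasurableSpace X] [Fintype L] [MeasurableSpace L]
    (η : Classifier X L) : IsMarkovKernel η.kernel :=
  ⟨fun x => ⟨cat_univ (η.mem_simplex x)⟩⟩

/-- The law `P_X × Cat(η(X))` of a pair `(X, Y)`. -/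
def pairLaw {X L : Type*} [MeasurableSpace X] [Fintype L] [MeasurableSpace L]
    (PX : Measure X) (η : Classifier X L) : Measure (X × L) :=
  PX ⊗ₘ η.kernel

/-- The law `P_X × Cat(η(X)) × Cat(η̂(X))` of a triplet `(X, Y, Y')`: given `X`, the labels
`Y ∼ Cat(η(X))` and `Y' ∼ Cat(η̂(X))` are independent. -/
def tripleLaw {X L : Type*} [MeasurableSpace X] [Fintype L] [MeasurableSpace L]
    (PX : Measure X) (η ηhat : Classifier X L) : Measure (X × L × L) :=
  PX ⊗ₘ (η.kernel ×ₖ ηhat.kernel)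

instance {X L : Type*} [MeasurableSpace X] [Fintype L] [MeasurableSpace L]
    (PX : Measure X) [IsProbabilityMeasure PX] (η : Classifier X L) :
    IsProbabilityMeasure (pairLaw PX η) := by
  unfold pairLaw; infer_instance

instance {X L : Type*} [MeasurableSpace X] [Fintype L] [MeasurableSpace L]
    (PX : Measure X) [IsProbabilityMeasure PX] (η ηhat : Classifier X L) :
    IsProbabilityMeasure (tripleLaw PX η ηhat) := by
  unfold tripleLaw; infer_instance

/-- The first-sample point `(x, y)` of a triplet `(x, y, y')`. -/
def fstPt {X L : Type*} (z : X × L × L) : X × L := (z.1, z.2.1)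

/-- The second-sample point `(x, y')` of a triplet `(x, y, y')`. -/
def sndPt {X L : Type*} (z : X × L × L) : X × L := (z.1, z.2.2)

/-- A distinguisher procedure: to a data set of any size `n`, consisting of triplets
`(x, y, y')`, it assigns a score function on feature-label pairs. -/
abbrev Distinguisher (X L : Type*) : Type _ :=
  (n : ℕ) → (Fin n → X × L × L) → X × L → ℝ

/-! ### Projections and the target variance -/

/-- The indicator `1(g(u) < g(v))`. -/
def rankInd {X L : Type*} (g : X × L → ℝ) (u v : X × L) : ℝ :=
  Set.indicator {p : (X × L) × (X × L) | g p.1 < g p.2} 1 (u, v)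

/-- `φ(x, y) = E_{X',Y'} 1(g(x, y) < g(X', Y'))`, where `(X', Y') ∼ P_X × Cat(η̂(X))`. -/
def phi {X L : Type*} [MeasurableSpace X] [Fintype L] [MeasurableSpace L]
    (PX : Measure X) (ηhat : Classifier X L) (g : X × L → ℝ) (u : X × L) : ℝ :=
  ∫ v, rankInd g u v ∂(pairLaw PX ηhat)

/-- `ψ(x', y') = E_{X,Y} 1(g(X, Y) < g(x', y'))`, where `(X, Y) ∼ P_X × Cat(η(X))`. -/
def psi {X L : Type*} [MeasurableSpace X] [Fintype L] [MeasurableSpace L]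
    (PX : Measure X) (η : Classifier X L) (g : X × L → ℝ) (v : X × L) : ℝ :=
  ∫ u, rankInd g u v ∂(pairLaw PX η)

/-- `Var(E[φ(X, Y; D_n) + ψ(X, Y'; D_n) | X, Y, Y'])`, where `D_n` consists of `n` iid triplets
and is independent of `(X, Y, Y')`; the conditional expectation given `(X, Y, Y')` is therefore
the expectation over `D_n` alone. -/
def sigmaSq {X L : Type*} [MeasurableSpace X] [Fintype L] [MeasurableSpace L]
    (PX : Measure X) (η ηhat : Classifier X L) (Dhat : Distinguisher X L) (n : ℕ) : ℝ :=
  Var[fun z : X × L × L =>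
      ∫ D : Fin n → X × L × L,
        (phi PX ηhat (Dhat n D) (fstPt z) + psi PX η (Dhat n D) (sndPt z))
        ∂(Measure.pi fun _ => tripleLaw PX η ηhat);
    tripleLaw PX η ηhat]

/-! ### The assumption -/

/-- `ν` has a density with respect to Lebesgue measure that is bounded by `B`. -/
def HasDensityBoundedBy (ν : Measure ℝ) (B : ℝ≥0) : Prop :=
  ∃ f : ℝ → ℝ≥0∞, Measurable f ∧ (∀ t, f t ≤ B) ∧ ν = volume.withDensity f

/-- `W` is `(κ, β)` sub-Weibull under `μ`. -/
def IsSubWeibull {Ω : Type*} [MeasurableSpace Ω] (μ : Measure Ω) (W : Ω → ℝ) (κ β : ℝ) : Prop :=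
  ∀ t : ℝ, 0 ≤ t → μ.real {ω | t ≤ |W ω|} ≤ 2 * Real.exp (-(t / κ) ^ (1 / β))

/-- The perturb-one difference `∇_i ĝ_n(u) = ĝ_{D_n}(u) - ĝ_{D_n^i}(u)`, as a function of
`(D_n, Z_i', u)`. -/
def perturb {X L : Type*} (Dhat : Distinguisher X L) (n : ℕ) (i : Fin n)
    (w : (Fin n → X × L × L) × (X × L × L) × (X × L)) : ℝ :=
  Dhat n w.1 w.2.2 - Dhat n (Function.update w.1 i w.2.1) w.2.2

/-- The non-degeneracy, stability and variance conditions for `K`-fold cross-fitting. -/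
structure Assumption {X L : Type*} [MeasurableSpace X] [Fintype L] [MeasurableSpace L]
    (K : ℕ) (PX : Measure X) (η ηhat : Classifier X L) (Dhat : Distinguisher X L) : Prop where
  /-- Scores fitted on any data set have densities bounded by a common constant. -/
  density : ∃ B : ℝ≥0, 0 < B ∧ ∀ n : ℕ, 1 ≤ n → ∀ D : Fin n → X × L × L,
    HasDensityBoundedBy ((pairLaw PX η).map (Dhat n D)) B ∧
    HasDensityBoundedBy ((pairLaw PX ηhat).map (Dhat n D)) B
  /-- Sub-Weibull stability; the data, the replacement `Z_i'` and the evaluation point are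
  independent. (For `n = 1` the scale `log(n)^{-β} n^{-1/2}` is infinite.) -/
  stability : ∃ β : ℝ, 0 < β ∧ ∀ n : ℕ, 2 ≤ n → ∀ i : Fin n,
    IsSubWeibull
      ((Measure.pi fun _ : Fin n => tripleLaw PX η ηhat).prod
        ((tripleLaw PX η ηhat).prod (pairLaw PX η)))
      (perturb Dhat n i) (Real.log n ^ (-β) * (n : ℝ) ^ (-(1 / 2 : ℝ))) β ∧
    IsSubWeibull
      ((Measure.pi fun _ : Fin n => tripleLaw PX η ηhat).prod
        ((tripleLaw PX η ηhat).prod (pairLaw PX ηhat)))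
      (perturb Dhat n i) (Real.log n ^ (-β) * (n : ℝ) ^ (-(1 / 2 : ℝ))) β
  /-- With folds of size `m`, the fitting sample size is `(K - 1) m`. -/
  variance_pos : ∃ c : ℝ, 0 < c ∧ ∀ m : ℕ, 1 ≤ m → c < sigmaSq PX η ηhat Dhat ((K - 1) * m)

/-! ### Folds and the variance estimator -/

/-- A partition of the `n = K m` sample indices into `K` folds of equal size `m`. -/
structure Folds (K m : ℕ) where
  fold : Fin (K * m) → Fin K
  card_fold : ∀ k, (Finset.univ.filter fun i => fold i = k).card = m

/-- The index set `I_{n,k}` of the `k`-th fold. -/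
def Folds.idx {K m : ℕ} (F : Folds K m) (k : Fin K) : Finset (Fin (K * m)) :=
  Finset.univ.filter fun i => F.fold i = k

theorem Folds.card_idx_compl {K m : ℕ} (F : Folds K m) (k : Fin K) :
    (F.idx k)ᶜ.card = (K - 1) * m := by
  rw [Finset.card_compl, Folds.idx, F.card_fold, Fintype.card_fin, Nat.sub_mul, one_mul]

/-- The fitting data `D_{n,-k}`: the data outside the `k`-th fold, in increasing index order. -/
def Folds.fitData {K m : ℕ} {Z : Type*} (F : Folds K m) (z : Fin (K * m) → Z) (k : Fin K) :
    Fin ((K - 1) * m) → Z :=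
  fun j => z ((F.idx k)ᶜ.orderEmbOfFin (F.card_idx_compl k) j)

section Estimators

variable {X L ι : Type*} (g : X × L → ℝ) (z : ι → X × L × L) (I : Finset ι)

/-- The empirical projection `φ̂` on the evaluation indices `I`. -/
def empPhi (u : X × L) : ℝ :=
  1 / (I.card : ℝ) * ∑ i ∈ I, rankInd g u (sndPt (z i))

/-- The empirical projection `ψ̂` on the evaluation indices `I`. -/
def empPsi (v : X × L) : ℝ :=
  1 / (I.card : ℝ) * ∑ i ∈ I, rankInd g (fstPt (z i)) v

/-- The rank-sum statistic `|I|⁻² ∑_{i,j ∈ I} R_{ij}` with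
`R_{ij} = 1(g(X_i, Y_i) < g(X_j, Y'_j))`. -/
def foldStat : ℝ :=
  1 / (I.card : ℝ) ^ 2 * ∑ i ∈ I, ∑ j ∈ I, rankInd g (fstPt (z i)) (sndPt (z j))

/-- The empirical variance on one fold. -/
def foldVar : ℝ :=
  1 / ((I.card : ℝ) - 1) * ∑ i ∈ I,
    (empPhi g z I (fstPt (z i)) + empPsi g z I (sndPt (z i)) - 2 * foldStat g z I) ^ 2

end Estimators

/-- The cross-fit variance estimator: the average over the folds of the fold-wise variances, the
score on the `k`-th fold being fitted on the data outside that fold. -/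
def crossVarEst {X L : Type*} {K m : ℕ} (Dhat : Distinguisher X L) (F : Folds K m)
    (z : Fin (K * m) → X × L × L) : ℝ :=
  1 / (K : ℝ) * ∑ k : Fin K, foldVar (Dhat ((K - 1) * m) (F.fitData z k)) z (F.idx k)

end CrossFit

end

namespace CrossFit

/-! ### Bounded functions, product measures and the Efron–Stein inequality -/

/-! Convergence is proved in mean square and turned into convergence in probability by Markov's
inequality; the lower bound `c` on the target variance then allows division. On each fold the error
is split at `projVar`, the variance over a fresh triplet of h = φ + ψ for the score actually fitted
on the other folds.

Evaluation error. The fitted score does not depend on the triplets of its own fold, so these stay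
iid given the score. The centring `2 * foldStat` is exactly the mean of the terms φ̂ + ψ̂, hence
`foldVar` is their sample variance. Each term differs from h by an average of conditionally centred
bounded variables, and the empirical first and second moments of h fluctuate in the same way. All of
this costs O(1/m) in mean square (`lintegral_sq_foldVar_sub_projVar_le`).

Fitting error. `sigmaSq` is the variance of the mean of h over the fitting data, so it suffices that
h be close to that mean in mean square (`sq_variance_sub_le`). For a fixed evaluation triplet,
Efron–Stein bounds this distance by a sum over the n fitting triplets of squared changes under
replacement of one of them. Each change is O(κ_n²), and n κ_n² = (log n)^(-2β) tends to 0.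

The delicate point is that the squared change of h must be quadratic in the change δ of the score. A
rank indicator is not Lipschitz in the score: bounding a squared probability by the probability
itself gives only order κ_n, and n κ_n diverges. The bounded densities restore the square in
`lintegral_sq_measure_near_snd_le`: the square of a probability is an integral over two points, both
close in score to a third, and whichever of the two has the larger δ confines both of the others to
intervals of length O(δ). -/

theorem integrable_of_abs_le {α : Type*} [MeasurableSpace α] {μ : Measure α} [IsFiniteMeasure μ]
    {f : α → ℝ} (hf : Measurable f) {C : ℝ} (h : ∀ x, |f x| ≤ C) : Integrable f μ :=
  Integrable.of_bound hf.aestronglyMeasurable C (ae_of_all _ h)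

/-- Resampling one coordinate does not change an iid law: the preimage of a box is the same box with
side `l` freed, times that side. This stands in for conditioning on all the other coordinates. -/
theorem measurePreserving_update {ι α : Type*} [Fintype ι] [DecidableEq ι] [MeasurableSpace α]
    (P : Measure α) [IsProbabilityMeasure P] (l : ι) :
    MeasurePreserving (fun p : (ι → α) × α => Function.update p.1 l p.2)
      ((Measure.pi fun _ => P).prod P) (Measure.pi fun _ => P) := by
  refine ⟨measurable_update', ?_⟩
  symm
  refine Measure.pi_eq fun s hs => ?_
  rw [Measure.map_apply measurable_update' (MeasurableSet.univ_pi hs)]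
  have : (fun p : (ι → α) × α => Function.update p.1 l p.2) ⁻¹' (Set.univ.pi s)
      = (Set.univ.pi (Function.update s l Set.univ)) ×ˢ (s l) := by
    ext ⟨z, w⟩
    simp only [Set.mem_preimage, Set.mem_pi, Set.mem_univ, true_implies, Set.mem_prod]
    constructor
    · intro h
      refine ⟨fun i => ?_, by simpa using h l⟩
      by_cases hi : i = l
      · subst hi; simp
      · simpa [hi] using h i
    · rintro ⟨h, hw⟩ i
      by_cases hi : i = l
      · subst hi; simpa using hw
      · simpa [hi] using h i
  rw [this, Measure.prod_prod, Measure.pi_pi,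
    ← Finset.prod_erase_mul (s := Finset.univ) (a := l) (fun i => P (s i)) (Finset.mem_univ l)]
  congr 1
  rw [← Finset.prod_erase_mul (s := Finset.univ) (a := l) _ (Finset.mem_univ l)]
  simp only [Function.update_self, measure_univ, mul_one]
  refine Finset.prod_congr rfl fun i hi => ?_
  rw [Function.update_of_ne (Finset.ne_of_mem_erase hi)]

theorem integral_pi_update {ι α : Type*} [Fintype ι] [DecidableEq ι] [MeasurableSpace α]
    (P : Measure α) [IsProbabilityMeasure P] (l : ι) {G : (ι → α) → ℝ} (hG : Measurable G)
    {C : ℝ} (hC : ∀ z, |G z| ≤ C) :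
    ∫ z, G z ∂(Measure.pi fun _ => P)
      = ∫ z, ∫ w, G (Function.update z l w) ∂P ∂(Measure.pi fun _ => P) := by
  have hmp := measurePreserving_update P l
  rw [← hmp.map_eq, integral_map hmp.measurable.aemeasurable hG.aestronglyMeasurable,
    integral_prod _ (integrable_of_abs_le (f := fun p : (ι → α) × α => G (Function.update p.1 l p.2))
      (hG.comp hmp.measurable) fun _ => hC _), hmp.map_eq]

theorem integral_pi_succ {α : Type*} [MeasurableSpace α] (P : Measure α) [IsProbabilityMeasure P]
    {n : ℕ} {G : (Fin (n + 1) → α) → ℝ} (hG : Measurable G) {C : ℝ} (hC : ∀ z, |G z| ≤ C) :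
    ∫ z, G z ∂(Measure.pi fun _ => P)
      = ∫ a, ∫ D, G (Fin.cons a D) ∂(Measure.pi fun _ => P) ∂P := by
  have hmp := (measurePreserving_piFinSuccAbove (fun _ : Fin (n + 1) => P) 0).symm
  rw [← hmp.integral_comp' G, integral_prod _
    (integrable_of_abs_le (f := fun p => G ((MeasurableEquiv.piFinSuccAbove _ 0).symm p))
      (hG.comp hmp.measurable) fun _ => hC _)]
  simp [MeasurableEquiv.piFinSuccAbove, Fin.insertNthEquiv]

theorem abs_integral_le_of_abs_le {α : Type*} [MeasurableSpace α] {μ : Measure α}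
    [IsProbabilityMeasure μ] {f : α → ℝ} {C : ℝ} (h : ∀ x, |f x| ≤ C) : |∫ x, f x ∂μ| ≤ C := by
  simpa using norm_integral_le_of_norm_le_const (μ := μ) (f := f) (ae_of_all _ h)

/-- Bias–variance decomposition; with `c = 0` it yields Jensen's inequality for the square, and with
`c` the global mean the induction step of Efron–Stein. -/
theorem integral_sub_const_sq {α : Type*} [MeasurableSpace α] {μ : Measure α}
    [IsProbabilityMeasure μ] {f : α → ℝ} (hf : Measurable f) {C : ℝ} (h : ∀ x, |f x| ≤ C)
    (c : ℝ) : ∫ x, (f x - c) ^ 2 ∂μ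
      = ∫ x, (f x - ∫ y, f y ∂μ) ^ 2 ∂μ + (∫ y, f y ∂μ - c) ^ 2 := by
  set M := ∫ y, f y ∂μ with hM
  have h1 := integrable_of_abs_le (μ := μ) hf h
  have h2 : Integrable (fun x => (f x - M) ^ 2) μ :=
    integrable_of_abs_le ((hf.sub_const M).pow_const 2) (C := (C + |M|) ^ 2) fun x => by
      rw [abs_pow]
      exact pow_le_pow_left₀ (abs_nonneg _) ((abs_sub _ _).trans (by linarith [h x])) 2
  have e : ∀ x, (f x - c) ^ 2 = (f x - M) ^ 2 + (2 * (M - c) * (f x - M) + (M - c) ^ 2) :=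
    fun x => by ring
  simp_rw [e]
  have h3 : Integrable (fun x => f x - M) μ := h1.sub (integrable_const _)
  have h4 : Integrable (fun x => 2 * (M - c) * (f x - M)) μ := h3.const_mul _
  have h5 : Integrable (fun x => 2 * (M - c) * (f x - M) + (M - c) ^ 2) μ :=
    h4.add (integrable_const _)
  rw [integral_add h2 h5, integral_add h4 (integrable_const _), integral_const_mul,
    integral_sub h1 (integrable_const _)]
  simp [← hM]

theorem sq_integral_le {α : Type*} [MeasurableSpace α] {μ : Measure α} [IsProbabilityMeasure μ]
    {f : α → ℝ} (hf : Measurable f) {C : ℝ} (h : ∀ x, |f x| ≤ C) :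
    (∫ x, f x ∂μ) ^ 2 ≤ ∫ x, f x ^ 2 ∂μ := by
  have := integral_sub_const_sq (μ := μ) hf h 0
  simp only [sub_zero] at this
  rw [this]
  exact le_add_of_nonneg_left (integral_nonneg fun x => sq_nonneg _)

/-- The Efron–Stein inequality for bounded functions (without the constant `1 / 2`). -/
theorem integral_sq_sub_le_sum_update {α : Type*} [MeasurableSpace α] (P : Measure α)
    [IsProbabilityMeasure P] {n : ℕ} {f : (Fin n → α) → ℝ} (hf : Measurable f) {C : ℝ}
    (hC : ∀ D, |f D| ≤ C) :
    ∫ D, (f D - ∫ D', f D' ∂(Measure.pi fun _ => P)) ^ 2 ∂(Measure.pi fun _ => P)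
      ≤ ∑ i, ∫ D, ∫ w, (f D - f (Function.update D i w)) ^ 2 ∂P ∂(Measure.pi fun _ => P) := by
  induction n with
  | zero =>
    have : ∀ D, f D - ∫ D', f D' ∂(Measure.pi fun _ => P) = 0 := fun D => by
      have h : ∀ D', f D' = f D := fun D' => by rw [Subsingleton.elim D' D]
      simp [h]
    simp [this]
  | succ n ih =>
    have hcons : Measurable fun p : α × (Fin n → α) => (Fin.cons p.1 p.2 : Fin (n + 1) → α) := by
      refine measurable_pi_lambda _ fun i => ?_
      refine Fin.cases ?_ (fun j => ?_) i
      · simpa using measurable_fst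
      · simpa [Function.comp_def] using (measurable_pi_apply j).comp measurable_snd
    have hfc : Measurable fun p : α × (Fin n → α) => f (Fin.cons p.1 p.2) := hf.comp hcons
    have hfa : ∀ a, Measurable fun D : Fin n → α => f (Fin.cons a D) := fun a =>
      hfc.comp measurable_prodMk_left
    have hFm : Measurable fun a => ∫ D, f (Fin.cons a D) ∂(Measure.pi fun _ : Fin n => P) :=
      hfc.stronglyMeasurable.integral_prod_right'.measurable
    have hFb : ∀ a, |∫ D, f (Fin.cons a D) ∂(Measure.pi fun _ : Fin n => P)| ≤ C := fun a =>
      abs_integral_le_of_abs_le fun D => hC _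
    have sqb : ∀ x y : ℝ, |x| ≤ C → |y| ≤ C → |(x - y) ^ 2| ≤ (2 * C) ^ 2 := fun x y hx hy => by
      rw [abs_pow]
      exact pow_le_pow_left₀ (abs_nonneg _) ((abs_sub _ _).trans (by linarith)) 2
    set M := ∫ D', f D' ∂(Measure.pi fun _ => P) with hM
    have hMb : |M| ≤ C := abs_integral_le_of_abs_le hC
    have hMF : M = ∫ a, ∫ D, f (Fin.cons a D) ∂(Measure.pi fun _ => P) ∂P :=
      integral_pi_succ P hf hC
    have hupd : ∀ i, Measurable fun p : (Fin (n + 1) → α) × α =>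
        (f p.1 - f (Function.update p.1 i p.2)) ^ 2 := fun i =>
      ((hf.comp measurable_fst).sub (hf.comp measurable_update')).pow_const 2
    have hupd' : ∀ i, Measurable fun D : Fin (n + 1) → α =>
        ∫ w, (f D - f (Function.update D i w)) ^ 2 ∂P := fun i =>
      (hupd i).stronglyMeasurable.integral_prod_right'.measurable
    have hupdb : ∀ i D, |∫ w, (f D - f (Function.update D i w)) ^ 2 ∂P| ≤ (2 * C) ^ 2 :=
      fun i D => abs_integral_le_of_abs_le fun w => sqb _ _ (hC _) (hC _)
    rw [integral_pi_succ P ((hf.sub_const M).pow_const 2) fun D => sqb _ _ (hC D) hMb]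
    -- Given the first coordinate `a`, the deviation from `M` splits into a conditional variance,
    -- left to the induction hypothesis, and the squared deviation of the conditional mean, paid for
    -- by the term `i = 0`.
    simp_rw [fun a => integral_sub_const_sq (μ := Measure.pi fun _ : Fin n => P) (hfa a)
      (fun D => hC _) M]
    have hV : Measurable fun a => ∫ D, (f (Fin.cons a D)
        - ∫ D', f (Fin.cons a D') ∂(Measure.pi fun _ : Fin n => P)) ^ 2
          ∂(Measure.pi fun _ : Fin n => P) := by
      refine (StronglyMeasurable.integral_prod_right' (f := fun p : α × (Fin n → α) =>
        (f (Fin.cons p.1 p.2) - ∫ D', f (Fin.cons p.1 D') ∂(Measure.pi fun _ : Fin n => P)) ^ 2)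
        ?_).measurable
      exact ((hfc.sub (hFm.comp measurable_fst)).pow_const 2).stronglyMeasurable
    rw [integral_add (integrable_of_abs_le hV (C := (2 * C) ^ 2) fun a =>
        abs_integral_le_of_abs_le fun D => sqb _ _ (hC _) (hFb a))
      (integrable_of_abs_le ((hFm.sub_const M).pow_const 2) fun a => sqb _ _ (hFb a) hMb),
      Fin.sum_univ_succ, add_comm]
    refine add_le_add ?_ ?_
    -- Jensen twice: `M` is the average of the conditional mean over a fresh first coordinate `w`,
    -- and both conditional means are averages over the same `D`.
    · have h1 : ∀ a, (∫ D, f (Fin.cons a D) ∂(Measure.pi fun _ : Fin n => P) - M) ^ 2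
          ≤ ∫ w, ∫ D, (f (Fin.cons a D) - f (Fin.cons w D)) ^ 2
            ∂(Measure.pi fun _ : Fin n => P) ∂P := by
        intro a
        have hd : Measurable fun w => ∫ D, f (Fin.cons a D) ∂(Measure.pi fun _ : Fin n => P)
            - ∫ D, f (Fin.cons w D) ∂(Measure.pi fun _ : Fin n => P) := hFm.const_sub _
        have e : ∫ D, f (Fin.cons a D) ∂(Measure.pi fun _ : Fin n => P) - M
            = ∫ w, (∫ D, f (Fin.cons a D) ∂(Measure.pi fun _ : Fin n => P)
              - ∫ D, f (Fin.cons w D) ∂(Measure.pi fun _ : Fin n => P)) ∂P := by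
          rw [integral_sub (integrable_const _) (integrable_of_abs_le hFm hFb), ← hMF]
          simp
        rw [e]
        refine (sq_integral_le hd (C := 2 * C) fun w =>
          (abs_sub _ _).trans (by linarith [hFb a, hFb w])).trans ?_
        have hm2 : Measurable fun p : α × (Fin n → α) =>
            (f (Fin.cons a p.2) - f (Fin.cons p.1 p.2)) ^ 2 :=
          (((hfa a).comp measurable_snd).sub hfc).pow_const 2
        refine integral_mono
          (integrable_of_abs_le (hd.pow_const 2) fun w => sqb _ _ (hFb a) (hFb w))
          (integrable_of_abs_le hm2.stronglyMeasurable.integral_prod_right'.measurable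
            (C := (2 * C) ^ 2) fun w => abs_integral_le_of_abs_le fun D => sqb _ _ (hC _) (hC _))
          fun w => ?_
        dsimp only
        rw [← integral_sub (integrable_of_abs_le (hfa a) fun _ => hC _)
          (integrable_of_abs_le (hfa w) fun _ => hC _)]
        exact sq_integral_le ((hfa a).sub (hfa w)) (C := 2 * C) fun D =>
          (abs_sub _ _).trans (by linarith [hC (Fin.cons a D), hC (Fin.cons w D)])
      rw [integral_pi_succ P (hupd' 0) (hupdb 0)]
      have hm3 : Measurable fun p : (α × α) × (Fin n → α) =>
          (f (Fin.cons p.1.1 p.2) - f (Fin.cons p.1.2 p.2)) ^ 2 :=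
        ((hfc.comp (measurable_fst.fst.prodMk measurable_snd)).sub
          (hfc.comp (measurable_fst.snd.prodMk measurable_snd))).pow_const 2
      have hm4 := hm3.stronglyMeasurable.integral_prod_right'
        (ν := Measure.pi fun _ : Fin n => P)
      have hm5 := hm4.integral_prod_right' (ν := P)
      have hb4 : ∀ a w, |∫ D, (f (Fin.cons a D) - f (Fin.cons w D)) ^ 2
          ∂(Measure.pi fun _ : Fin n => P)| ≤ (2 * C) ^ 2 := fun a w =>
        abs_integral_le_of_abs_le fun D => sqb _ _ (hC _) (hC _)
      refine (integral_mono (integrable_of_abs_le ((hFm.sub_const M).pow_const 2)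
        fun a => sqb _ _ (hFb a) hMb) (integrable_of_abs_le hm5.measurable (C := (2 * C) ^ 2)
          fun a => abs_integral_le_of_abs_le fun w => hb4 a w) h1).trans (le_of_eq ?_)
      refine integral_congr_ae (ae_of_all _ fun a => ?_)
      dsimp only
      rw [integral_integral_swap]
      · simp only [Fin.update_cons_zero]
      · exact integrable_of_abs_le (((((hfa a).comp measurable_snd).sub hfc)).pow_const 2)
          fun p => sqb _ _ (hC _) (hC _)
    · have hmi : ∀ i : Fin n, Measurable fun a => ∫ D, ∫ w,
          (f (Fin.cons a D) - f (Fin.cons a (Function.update D i w))) ^ 2 ∂P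
            ∂(Measure.pi fun _ : Fin n => P) := fun i => by
        have := ((hupd' i.succ).comp hcons).stronglyMeasurable.integral_prod_right'
          (ν := Measure.pi fun _ : Fin n => P)
        simpa only [Function.comp_def, ← Fin.cons_update] using this.measurable
      have hbi : ∀ i : Fin n, ∀ a, |∫ D, ∫ w,
          (f (Fin.cons a D) - f (Fin.cons a (Function.update D i w))) ^ 2 ∂P
            ∂(Measure.pi fun _ : Fin n => P)| ≤ (2 * C) ^ 2 := fun i a =>
        abs_integral_le_of_abs_le fun D => abs_integral_le_of_abs_le fun w =>
          sqb _ _ (hC _) (hC _)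
      simp_rw [fun i : Fin n => integral_pi_succ P (hupd' i.succ) (hupdb i.succ),
        ← Fin.cons_update]
      rw [← integral_finsetSum _ fun i _ => integrable_of_abs_le (hmi i) (hbi i)]
      refine integral_mono (integrable_of_abs_le hV (C := (2 * C) ^ 2) fun a =>
        abs_integral_le_of_abs_le fun D => sqb _ _ (hC _) (hFb a))
        (integrable_finsetSum _ fun i _ => integrable_of_abs_le (hmi i) (hbi i)) fun a => ?_
      exact ih (hfa a) fun D => hC _

theorem lintegral_sq_sub_le_sum_update {α : Type*} [MeasurableSpace α] (P : Measure α)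
    [IsProbabilityMeasure P] {n : ℕ} {f : (Fin n → α) → ℝ} (hf : Measurable f) {C : ℝ}
    (hC : ∀ D, |f D| ≤ C) :
    ∫⁻ D, ENNReal.ofReal ((f D - ∫ D', f D' ∂(Measure.pi fun _ => P)) ^ 2)
        ∂(Measure.pi fun _ => P)
      ≤ ∑ i, ∫⁻ p, ENNReal.ofReal ((f p.1 - f (Function.update p.1 i p.2)) ^ 2)
        ∂((Measure.pi fun _ => P).prod P) := by
  have sqb : ∀ x y : ℝ, |x| ≤ C → |y| ≤ C → |(x - y) ^ 2| ≤ (2 * C) ^ 2 := fun x y hx hy => by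
    rw [abs_pow]
    exact pow_le_pow_left₀ (abs_nonneg _) ((abs_sub _ _).trans (by linarith)) 2
  have hmean : |∫ D', f D' ∂(Measure.pi fun _ => P)| ≤ C := abs_integral_le_of_abs_le hC
  rw [← ofReal_integral_eq_lintegral_ofReal
    (integrable_of_abs_le ((hf.sub_const _).pow_const 2) fun D => sqb _ _ (hC D) hmean)
    (ae_of_all _ fun D => sq_nonneg _)]
  refine (ENNReal.ofReal_le_ofReal (integral_sq_sub_le_sum_update P hf hC)).trans (le_of_eq ?_)
  rw [ENNReal.ofReal_sum_of_nonneg fun i _ => integral_nonneg fun D =>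
    integral_nonneg fun w => sq_nonneg _]
  refine Finset.sum_congr rfl fun i _ => ?_
  have hj : Measurable fun p : (Fin n → α) × α =>
      (f p.1 - f (Function.update p.1 i p.2)) ^ 2 :=
    ((hf.comp measurable_fst).sub (hf.comp measurable_update')).pow_const 2
  rw [lintegral_prod _ hj.ennreal_ofReal.aemeasurable, ofReal_integral_eq_lintegral_ofReal
    (integrable_of_abs_le hj.stronglyMeasurable.integral_prod_right'.measurable
      fun D => abs_integral_le_of_abs_le fun w => sqb _ _ (hC _) (hC _))
    (ae_of_all _ fun D => integral_nonneg fun w => sq_nonneg _)]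
  refine lintegral_congr fun D => ?_
  exact ofReal_integral_eq_lintegral_ofReal
    (integrable_of_abs_le (hj.comp measurable_prodMk_left) fun w => sqb _ _ (hC _) (hC _))
    (ae_of_all _ fun w => sq_nonneg _)

/-! ### Second moments of sub-Weibull variables -/

/-- Layer-cake formula: the second moment is at most 4 ∫ t exp(-(t/κ)^(1/β)) dt, a Gamma integral.
What matters later is the order κ². -/
theorem lintegral_sq_le_of_isSubWeibull {Ω : Type*} [MeasurableSpace Ω] {μ : Measure Ω}
    [IsFiniteMeasure μ] {W : Ω → ℝ} (hW : Measurable W) {κ β : ℝ} (hκ : 0 < κ) (hβ : 0 < β)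
    (h : IsSubWeibull μ W κ β) :
    ∫⁻ ω, ENNReal.ofReal (W ω ^ 2) ∂μ
      ≤ ENNReal.ofReal (4 * β * Real.Gamma (2 * β) * κ ^ 2) := by
  have e : ∀ ω, W ω ^ 2 = |W ω| ^ (2 : ℝ) := fun ω => by
    rw [Real.rpow_two, sq_abs]
  simp_rw [e]
  rw [lintegral_rpow_eq_lintegral_meas_le_mul μ (ae_of_all _ fun ω => abs_nonneg _)
    hW.abs.aemeasurable two_pos]
  set b : ℝ := (1 / κ) ^ (1 / β) with hb
  have hb0 : 0 < b := by positivity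
  have hint := integral_rpow_mul_exp_neg_mul_rpow (p := 1 / β) (q := 1) (b := b)
    (by positivity) (by norm_num) hb0
  have hon := integrableOn_rpow_mul_exp_neg_mul_rpow (p := 1 / β) (s := 1) (b := b)
    (by norm_num) (by positivity) hb0
  have hexp : b ^ (-(1 + 1) / (1 / β)) = κ ^ 2 := by
    rw [hb, ← Real.rpow_mul (by positivity),
      show 1 / β * (-(1 + 1) / (1 / β)) = -2 by field_simp; norm_num, one_div,
      Real.inv_rpow hκ.le, Real.rpow_neg hκ.le, inv_inv, Real.rpow_two]
  have hle : ∫⁻ t in Set.Ioi (0 : ℝ), μ {a | t ≤ |W a|} * ENNReal.ofReal (t ^ ((2 : ℝ) - 1))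
      ≤ ∫⁻ t in Set.Ioi (0 : ℝ),
        ENNReal.ofReal (2 * (t ^ (1 : ℝ) * Real.exp (-b * t ^ (1 / β)))) := by
    refine setLIntegral_mono' measurableSet_Ioi fun t ht => ?_
    have ht0 : (0 : ℝ) < t := ht
    have h1 := h t ht0.le
    rw [← ofReal_measureReal, ← ENNReal.ofReal_mul measureReal_nonneg]
    refine ENNReal.ofReal_le_ofReal ?_
    have e2 : (t / κ) ^ (1 / β) = b * t ^ (1 / β) := by
      rw [hb, ← Real.mul_rpow (by positivity) ht0.le]
      congr 1
      field_simp
    rw [e2, ← neg_mul] at h1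
    norm_num only [Real.rpow_one]
    nlinarith [mul_le_mul_of_nonneg_right h1 ht0.le]
  refine (mul_le_mul_right hle _).trans (le_of_eq ?_)
  rw [← ofReal_integral_eq_lintegral_ofReal (hon.const_mul 2), integral_const_mul, hint, hexp,
    ← ENNReal.ofReal_mul zero_le_two]
  · congr 1
    rw [show ((1 : ℝ) + 1) / (1 / β) = 2 * β by field_simp; norm_num]
    field_simp
    norm_num
  · filter_upwards [ae_restrict_mem measurableSet_Ioi] with t ht
    have : (0 : ℝ) < t := ht
    positivity

/-! ### Perturbation of ranks under bounded densities -/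

/-- If the law of `g` under `Q` has a density bounded by `B`, then intervals have small mass. -/
theorem HasDensityBoundedBy.measure_abs_sub_le {U : Type*} [MeasurableSpace U] {Q : Measure U}
    {g : U → ℝ} (hg : Measurable g) {B : ℝ≥0} (h : HasDensityBoundedBy (Q.map g) B) (t r : ℝ) :
    Q {u | |g u - t| ≤ r} ≤ B * ENNReal.ofReal (2 * r) := by
  obtain ⟨f, hf, hfB, hν⟩ := h
  have hm : MeasurableSet {s : ℝ | |s - t| ≤ r} :=
    measurableSet_le (measurable_id.sub_const t).abs measurable_const
  have h1 : Q {u | |g u - t| ≤ r} = Q.map g {s | |s - t| ≤ r} := by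
    rw [Measure.map_apply hg hm]; rfl
  rw [h1, hν, withDensity_apply _ hm]
  refine (setLIntegral_mono measurable_const fun s _ => hfB s).trans (le_of_eq ?_)
  rw [setLIntegral_const, ← Real.volume_closedBall t r]
  rfl

/-- If both `v` and `w` are near `u`, the one with the larger tolerance also has the other within
four times that tolerance, by the triangle inequality. -/
theorem indicator_mul_indicator_le {U : Type*} {g δ : U → ℝ} (u v w : U) :
    ({p : U × U | |g p.1 - g p.2| ≤ 2 * δ p.2}.indicator (1 : U × U → ℝ≥0∞) (u, v))
        * ({p : U × U | |g p.1 - g p.2| ≤ 2 * δ p.2}.indicator (1 : U × U → ℝ≥0∞) (u, w))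
      ≤ ({p : U × U | |g p.1 - g p.2| ≤ 2 * δ p.2}.indicator (1 : U × U → ℝ≥0∞) (u, v))
          * ({p : U × U | |g p.1 - g p.2| ≤ 4 * δ p.2}.indicator (1 : U × U → ℝ≥0∞) (w, v))
        + ({p : U × U | |g p.1 - g p.2| ≤ 2 * δ p.2}.indicator (1 : U × U → ℝ≥0∞) (u, w))
          * ({p : U × U | |g p.1 - g p.2| ≤ 4 * δ p.2}.indicator (1 : U × U → ℝ≥0∞) (v, w)) := by
  by_cases h1 : |g u - g v| ≤ 2 * δ v
  · by_cases h2 : |g u - g w| ≤ 2 * δ w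
    · have h3 : |g v - g w| ≤ 4 * δ w ∨ |g w - g v| ≤ 4 * δ v := by
        rw [abs_le] at h1 h2
        rcases le_total (δ v) (δ w) with h | h
        · left; rw [abs_le]; constructor <;> linarith
        · right; rw [abs_le]; constructor <;> linarith
      rcases h3 with h3 | h3
      · simp [Set.indicator, h1, h2, h3]
      · simp [Set.indicator, h1, h2, h3]
    · simp [Set.indicator, h2]
  · simp [Set.indicator, h1]

section Neighbours

variable {U : Type*} [MeasurableSpace U] {Q Q' : Measure U} [IsProbabilityMeasure Q]
  [IsProbabilityMeasure Q'] {g δ : U → ℝ} {B : ℝ≥0}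

theorem measurableSet_near (hg : Measurable g) (hδ : Measurable δ) (c : ℝ) :
    MeasurableSet {p : U × U | |g p.1 - g p.2| ≤ c * δ p.2} :=
  measurableSet_le ((hg.comp measurable_fst).sub (hg.comp measurable_snd)).abs
    ((hδ.comp measurable_snd).const_mul c)

/-- The hard case, where the tolerance belongs to the point being integrated, so that no single
interval contains the set. Expanding the square over two points `v`, `w` and keeping the one with
the larger tolerance, both other points lie in intervals around its score, which produces δ² instead
of δ. -/
theorem lintegral_sq_measure_near_snd_le (hg : Measurable g) (hδ : Measurable δ)
    (hδ0 : ∀ u, 0 ≤ δ u)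
    (hQ : ∀ t r, Q {u | |g u - t| ≤ r} ≤ B * ENNReal.ofReal (2 * r))
    (hQ' : ∀ t r, Q' {u | |g u - t| ≤ r} ≤ B * ENNReal.ofReal (2 * r)) :
    ∫⁻ u, Q' {v | |g u - g v| ≤ 2 * δ v} ^ 2 ∂Q
      ≤ 64 * (B : ℝ≥0∞) ^ 2 * ∫⁻ v, ENNReal.ofReal (δ v ^ 2) ∂Q' := by
  set a : U × U → ℝ≥0∞ := {p : U × U | |g p.1 - g p.2| ≤ 2 * δ p.2}.indicator 1 with ha
  set b : U × U → ℝ≥0∞ := {p : U × U | |g p.1 - g p.2| ≤ 4 * δ p.2}.indicator 1 with hb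
  have hma : Measurable a := measurable_one.indicator (measurableSet_near hg hδ 2)
  have hmb : Measurable b := measurable_one.indicator (measurableSet_near hg hδ 4)
  have hau : ∀ u, ∫⁻ v, a (u, v) ∂Q' = Q' {v | |g u - g v| ≤ 2 * δ v} := fun u =>
    lintegral_indicator_one (measurable_prodMk_left (measurableSet_near hg hδ 2))
  have hav : ∀ v, ∫⁻ u, a (u, v) ∂Q ≤ B * ENNReal.ofReal (4 * δ v) := fun v => by
    rw [show 4 * δ v = 2 * (2 * δ v) by ring]
    refine le_trans (le_of_eq ?_) (hQ (g v) (2 * δ v))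
    exact lintegral_indicator_one (s := {u | |g u - g v| ≤ 2 * δ v})
      (measurable_prodMk_right (measurableSet_near hg hδ 2))
  have hbv : ∀ w, ∫⁻ v, b (v, w) ∂Q' ≤ B * ENNReal.ofReal (8 * δ w) := fun w => by
    rw [show 8 * δ w = 2 * (4 * δ w) by ring]
    refine le_trans (le_of_eq ?_) (hQ' (g w) (4 * δ w))
    exact lintegral_indicator_one (s := {u | |g u - g w| ≤ 4 * δ w})
      (measurable_prodMk_right (measurableSet_near hg hδ 4))
  -- Here `w` is the point with the larger tolerance. Integrating out `v`, then `u`, leaves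
  -- (8Bδ(w))(4Bδ(w)), whence the constant 32.
  have key : ∫⁻ u, ∫⁻ w, ∫⁻ v, a (u, w) * b (v, w) ∂Q' ∂Q' ∂Q
      ≤ 32 * (B : ℝ≥0∞) ^ 2 * ∫⁻ v, ENNReal.ofReal (δ v ^ 2) ∂Q' := by
    calc ∫⁻ u, ∫⁻ w, ∫⁻ v, a (u, w) * b (v, w) ∂Q' ∂Q' ∂Q
        ≤ ∫⁻ u, ∫⁻ w, a (u, w) * (B * ENNReal.ofReal (8 * δ w)) ∂Q' ∂Q := by
          refine lintegral_mono fun u => lintegral_mono fun w => ?_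
          dsimp only
          rw [lintegral_const_mul (f := fun v => b (v, w)) _ (hmb.comp measurable_prodMk_right)]
          gcongr
          exact hbv w
      _ = ∫⁻ w, ∫⁻ u, a (u, w) * (B * ENNReal.ofReal (8 * δ w)) ∂Q ∂Q' := by
          refine lintegral_lintegral_swap (Measurable.aemeasurable ?_)
          exact hma.mul (((hδ.comp measurable_snd).const_mul 8).ennreal_ofReal.const_mul _)
      _ ≤ ∫⁻ w, B * ENNReal.ofReal (4 * δ w) * (B * ENNReal.ofReal (8 * δ w)) ∂Q' := by
          refine lintegral_mono fun w => ?_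
          dsimp only
          rw [lintegral_mul_const (f := fun u => a (u, w)) _ (hma.comp measurable_prodMk_right)]
          gcongr
          exact hav w
      _ = ∫⁻ w, 32 * (B : ℝ≥0∞) ^ 2 * ENNReal.ofReal (δ w ^ 2) ∂Q' := by
          refine lintegral_congr fun w => ?_
          rw [ENNReal.ofReal_mul (by norm_num), ENNReal.ofReal_mul (by norm_num),
            ENNReal.ofReal_pow (hδ0 w)]
          norm_num
          ring
      _ = _ := lintegral_const_mul _ (hδ.pow_const 2).ennreal_ofReal
  calc ∫⁻ u, Q' {v | |g u - g v| ≤ 2 * δ v} ^ 2 ∂Q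
      = ∫⁻ u, ∫⁻ w, ∫⁻ v, a (u, v) * a (u, w) ∂Q' ∂Q' ∂Q := by
        refine lintegral_congr fun u => ?_
        have hmu : Measurable fun v => a (u, v) := hma.comp measurable_prodMk_left
        simp_rw [lintegral_mul_const _ hmu]
        rw [lintegral_const_mul _ hmu, hau, sq]
    _ ≤ ∫⁻ u, ∫⁻ w, ∫⁻ v, (a (u, v) * b (w, v) + a (u, w) * b (v, w)) ∂Q' ∂Q' ∂Q := by
        refine lintegral_mono fun u => lintegral_mono fun w => lintegral_mono fun v => ?_
        dsimp only
        exact indicator_mul_indicator_le u v w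
    _ = ∫⁻ u, ((∫⁻ w, ∫⁻ v, a (u, v) * b (w, v) ∂Q' ∂Q')
          + ∫⁻ w, ∫⁻ v, a (u, w) * b (v, w) ∂Q' ∂Q') ∂Q := by
        refine lintegral_congr fun u => ?_
        have hmu : Measurable fun v => a (u, v) := hma.comp measurable_prodMk_left
        have h1 : Measurable fun p : U × U => a (u, p.2) * b p :=
          (hmu.comp measurable_snd).mul hmb
        rw [← lintegral_add_left h1.lintegral_prod_right']
        refine lintegral_congr fun w => ?_
        exact lintegral_add_left (h1.comp measurable_prodMk_left) _
    -- The two halves differ only by exchanging `v` and `w`, which have the same law.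
    _ = ∫⁻ u, ((∫⁻ w, ∫⁻ v, a (u, w) * b (v, w) ∂Q' ∂Q')
          + ∫⁻ w, ∫⁻ v, a (u, w) * b (v, w) ∂Q' ∂Q') ∂Q := by
        refine lintegral_congr fun u => ?_
        have hmu : Measurable fun v => a (u, v) := hma.comp measurable_prodMk_left
        congr 1
        exact lintegral_lintegral_swap ((hmu.comp measurable_snd).mul hmb).aemeasurable
    _ = 2 * ∫⁻ u, ∫⁻ w, ∫⁻ v, a (u, w) * b (v, w) ∂Q' ∂Q' ∂Q := by
        simp_rw [← two_mul]
        refine lintegral_const_mul _ ?_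
        have h2 : Measurable fun p : (U × U) × U => a p.1 * b (p.2, p.1.2) :=
          (hma.comp measurable_fst).mul (hmb.comp (measurable_snd.prodMk measurable_fst.snd))
        exact h2.lintegral_prod_right'.lintegral_prod_right'
    _ ≤ 2 * (32 * (B : ℝ≥0∞) ^ 2 * ∫⁻ v, ENNReal.ofReal (δ v ^ 2) ∂Q') := by gcongr
    _ = _ := by rw [← mul_assoc, ← mul_assoc]; norm_num

theorem ennreal_add_sq_le (x y : ℝ≥0∞) : (x + y) ^ 2 ≤ 2 * (x ^ 2 + y ^ 2) := by
  have := ENNReal.rpow_add_le_mul_rpow_add_rpow x y (p := 2) (by norm_num)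
  norm_num at this
  exact this

/-- If two scores differ by at most `δ`, the points whose rank relation to `u` can change have,
in mean square over `u`, probability of the order of `δ`. -/
theorem lintegral_sq_measure_near_le (hg : Measurable g) (hδ : Measurable δ)
    (hδ0 : ∀ u, 0 ≤ δ u)
    (hQ : ∀ t r, Q {u | |g u - t| ≤ r} ≤ B * ENNReal.ofReal (2 * r))
    (hQ' : ∀ t r, Q' {u | |g u - t| ≤ r} ≤ B * ENNReal.ofReal (2 * r)) :
    ∫⁻ u, Q' {v | |g u - g v| ≤ δ u + δ v} ^ 2 ∂Q
      ≤ 128 * (B : ℝ≥0∞) ^ 2 * (∫⁻ u, ENNReal.ofReal (δ u ^ 2) ∂Q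
        + ∫⁻ v, ENNReal.ofReal (δ v ^ 2) ∂Q') := by
  -- If δ(u) is the larger tolerance, the set is inside an interval fixed by `u` and the density
  -- bound applies at once; otherwise the preceding lemma is needed.
  have hsub : ∀ u, Q' {v | |g u - g v| ≤ δ u + δ v}
      ≤ B * ENNReal.ofReal (4 * δ u) + Q' {v | |g u - g v| ≤ 2 * δ v} := fun u => by
    have h1 : {v | |g u - g v| ≤ δ u + δ v}
        ⊆ {v | |g v - g u| ≤ 2 * δ u} ∪ {v | |g u - g v| ≤ 2 * δ v} := by
      intro v hv
      simp only [Set.mem_ofPred_eq, Set.mem_union] at hv ⊢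
      rw [abs_sub_comm (g v)]
      rcases le_total (δ u) (δ v) with h | h
      · right; linarith
      · left; linarith
    refine (measure_mono h1).trans ((measure_union_le _ _).trans ?_)
    gcongr
    rw [show 4 * δ u = 2 * (2 * δ u) by ring]
    exact hQ' _ _
  have hm : Measurable fun u => (B * ENNReal.ofReal (4 * δ u)) ^ 2 :=
    ((hδ.const_mul 4).ennreal_ofReal.const_mul _).pow_const 2
  calc ∫⁻ u, Q' {v | |g u - g v| ≤ δ u + δ v} ^ 2 ∂Q
      ≤ ∫⁻ u, 2 * ((B * ENNReal.ofReal (4 * δ u)) ^ 2 + Q' {v | |g u - g v| ≤ 2 * δ v} ^ 2) ∂Q :=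
        lintegral_mono fun u => (pow_le_pow_left' (hsub u) 2).trans (ennreal_add_sq_le _ _)
    _ = 2 * (∫⁻ u, (B * ENNReal.ofReal (4 * δ u)) ^ 2 ∂Q
          + ∫⁻ u, Q' {v | |g u - g v| ≤ 2 * δ v} ^ 2 ∂Q) := by
        rw [lintegral_const_mul' _ _ (by norm_num), lintegral_add_left hm]
    _ ≤ 2 * (16 * (B : ℝ≥0∞) ^ 2 * ∫⁻ u, ENNReal.ofReal (δ u ^ 2) ∂Q
          + 64 * (B : ℝ≥0∞) ^ 2 * ∫⁻ v, ENNReal.ofReal (δ v ^ 2) ∂Q') := by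
        gcongr
        · rw [← lintegral_const_mul _ (hδ.pow_const 2).ennreal_ofReal]
          refine le_of_eq (lintegral_congr fun u => ?_)
          rw [ENNReal.ofReal_mul (by norm_num), ENNReal.ofReal_pow (hδ0 u)]
          norm_num
          ring
        · exact lintegral_sq_measure_near_snd_le hg hδ hδ0 hQ hQ'
    _ ≤ 2 * (64 * (B : ℝ≥0∞) ^ 2 * ∫⁻ u, ENNReal.ofReal (δ u ^ 2) ∂Q
          + 64 * (B : ℝ≥0∞) ^ 2 * ∫⁻ v, ENNReal.ofReal (δ v ^ 2) ∂Q') := by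
        gcongr
        norm_num
    _ = _ := by rw [← mul_add, ← mul_assoc, ← mul_assoc]; norm_num

end Neighbours

/-! ### Rank projections: measurability and bounds -/

theorem rankInd_eq {X L : Type*} (g : X × L → ℝ) (u v : X × L) :
    rankInd g u v = if g u < g v then 1 else 0 := by
  simp [rankInd, Set.indicator]

theorem rankInd_nonneg {X L : Type*} (g : X × L → ℝ) (u v : X × L) : 0 ≤ rankInd g u v := by
  rw [rankInd_eq]; split_ifs <;> norm_num

theorem rankInd_le_one {X L : Type*} (g : X × L → ℝ) (u v : X × L) : rankInd g u v ≤ 1 := by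
  rw [rankInd_eq]; split_ifs <;> norm_num

theorem abs_rankInd_le {X L : Type*} (g : X × L → ℝ) (u v : X × L) : |rankInd g u v| ≤ 1 :=
  abs_le.2 ⟨by linarith [rankInd_nonneg g u v], rankInd_le_one g u v⟩

theorem measurable_rankInd {A X L : Type*} [MeasurableSpace A] [MeasurableSpace X]
    [MeasurableSpace L] {G : A → X × L → ℝ}
    (hG : Measurable fun p : A × (X × L) => G p.1 p.2) :
    Measurable fun p : A × (X × L) × (X × L) => rankInd (G p.1) p.2.1 p.2.2 := by
  simp_rw [rankInd_eq]
  exact Measurable.ite (measurableSet_lt (hG.comp (measurable_fst.prodMk measurable_snd.fst))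
    (hG.comp (measurable_fst.prodMk measurable_snd.snd))) measurable_const measurable_const

theorem measurable_fstPt {X L : Type*} [MeasurableSpace X] [MeasurableSpace L] :
    Measurable (fstPt : X × L × L → X × L) := measurable_fst.prodMk measurable_snd.fst

theorem measurable_sndPt {X L : Type*} [MeasurableSpace X] [MeasurableSpace L] :
    Measurable (sndPt : X × L × L → X × L) := measurable_fst.prodMk measurable_snd.snd

section Projections

variable {X L : Type*} [MeasurableSpace X] [Fintype L] [MeasurableSpace L]
  (PX : Measure X) [IsProbabilityMeasure PX] (η ηhat : Classifier X L)

theorem measurePreserving_fstPt :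
    MeasurePreserving fstPt (tripleLaw PX η ηhat) (pairLaw PX η) := by
  refine ⟨measurable_fstPt, ?_⟩
  have h := Measure.compProd_map (μ := PX) (κ := η.kernel ×ₖ ηhat.kernel)
    (f := Prod.fst) measurable_fst
  rw [← Kernel.fst_eq, Kernel.fst_prod] at h
  exact h.symm

theorem measurePreserving_sndPt :
    MeasurePreserving sndPt (tripleLaw PX η ηhat) (pairLaw PX ηhat) := by
  refine ⟨measurable_sndPt, ?_⟩
  have h := Measure.compProd_map (μ := PX) (κ := η.kernel ×ₖ ηhat.kernel)
    (f := Prod.snd) measurable_snd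
  rw [← Kernel.snd_eq, Kernel.snd_prod] at h
  exact h.symm

/-- The sum `φ(x, y) + ψ(x, y')` of the two projections at a triplet. -/
noncomputable def proj (g : X × L → ℝ) (z : X × L × L) : ℝ :=
  phi PX ηhat g (fstPt z) + psi PX η g (sndPt z)

theorem integral_mem_Icc {α : Type*} [MeasurableSpace α] {μ : Measure α}
    [IsProbabilityMeasure μ] {f : α → ℝ} (h0 : ∀ x, 0 ≤ f x) (h1 : ∀ x, f x ≤ 1) :
    ∫ x, f x ∂μ ∈ Set.Icc (0 : ℝ) 1 :=
  ⟨integral_nonneg h0, (abs_le.1 (abs_integral_le_of_abs_le fun x =>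
    abs_le.2 ⟨by linarith [h0 x], h1 x⟩)).2⟩

theorem phi_mem_Icc (g : X × L → ℝ) (u : X × L) : phi PX ηhat g u ∈ Set.Icc (0 : ℝ) 1 :=
  integral_mem_Icc (fun v => rankInd_nonneg g u v) fun v => rankInd_le_one g u v

theorem psi_mem_Icc (g : X × L → ℝ) (v : X × L) : psi PX η g v ∈ Set.Icc (0 : ℝ) 1 :=
  integral_mem_Icc (fun u => rankInd_nonneg g u v) fun u => rankInd_le_one g u v

theorem proj_mem_Icc (g : X × L → ℝ) (z : X × L × L) :
    proj PX η ηhat g z ∈ Set.Icc (0 : ℝ) 2 := by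
  have h1 := phi_mem_Icc PX ηhat g (fstPt z)
  have h2 := psi_mem_Icc PX η g (sndPt z)
  exact ⟨add_nonneg h1.1 h2.1, by unfold proj; linarith [h1.2, h2.2]⟩

theorem abs_proj_le (g : X × L → ℝ) (z : X × L × L) : |proj PX η ηhat g z| ≤ 2 :=
  abs_le.2 ⟨by linarith [(proj_mem_Icc PX η ηhat g z).1], (proj_mem_Icc PX η ηhat g z).2⟩

variable {A : Type*} [MeasurableSpace A] {G : A → X × L → ℝ}

theorem measurable_phi (hG : Measurable fun p : A × (X × L) => G p.1 p.2) :
    Measurable fun p : A × (X × L) => phi PX ηhat (G p.1) p.2 := by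
  refine (StronglyMeasurable.integral_prod_right'
    (f := fun p : (A × (X × L)) × (X × L) => rankInd (G p.1.1) p.1.2 p.2) ?_).measurable
  exact ((measurable_rankInd hG).comp
    (measurable_fst.fst.prodMk (measurable_fst.snd.prodMk measurable_snd))).stronglyMeasurable

theorem measurable_psi (hG : Measurable fun p : A × (X × L) => G p.1 p.2) :
    Measurable fun p : A × (X × L) => psi PX η (G p.1) p.2 := by
  refine (StronglyMeasurable.integral_prod_right'
    (f := fun p : (A × (X × L)) × (X × L) => rankInd (G p.1.1) p.2 p.1.2) ?_).measurable
  exact ((measurable_rankInd hG).comp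
    (measurable_fst.fst.prodMk (measurable_snd.prodMk measurable_fst.snd))).stronglyMeasurable

theorem measurable_proj (hG : Measurable fun p : A × (X × L) => G p.1 p.2) :
    Measurable fun p : A × (X × L × L) => proj PX η ηhat (G p.1) p.2 :=
  ((measurable_phi PX ηhat hG).comp
    (measurable_fst.prodMk (measurable_fstPt.comp measurable_snd))).add
  ((measurable_psi PX η hG).comp
    (measurable_fst.prodMk (measurable_sndPt.comp measurable_snd)))

end Projections

/-! ### Stability of the projections -/

/-- Passing from `g` to `g'` can change the order of two scores only if the gap under `g` is at most
the sum of the two displacements. The condition involves gaps of `g` alone, so only `g` needs a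
bounded density. -/
theorem abs_rankInd_sub_le {X L : Type*} (g g' : X × L → ℝ) (u v : X × L) :
    |rankInd g u v - rankInd g' u v|
      ≤ {p : (X × L) × (X × L) |
          |g p.1 - g p.2| ≤ |g p.1 - g' p.1| + |g p.2 - g' p.2|}.indicator 1 (u, v) := by
  by_cases h : |g u - g v| ≤ |g u - g' u| + |g v - g' v|
  · rw [Set.indicator_of_mem (by exact h), Pi.one_apply, abs_le]
    constructor <;> linarith [rankInd_nonneg g u v, rankInd_nonneg g' u v,
      rankInd_le_one g u v, rankInd_le_one g' u v]
  · rw [Set.indicator_of_notMem (by exact h)]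
    have : (g u < g v) ↔ (g' u < g' v) := by
      push Not at h
      have h1 := neg_abs_le (g u - g' u)
      have h2 := le_abs_self (g u - g' u)
      have h3 := neg_abs_le (g v - g' v)
      have h4 := le_abs_self (g v - g' v)
      constructor
      · intro h5
        rw [abs_of_neg (sub_neg.2 h5 : g u - g v < 0)] at h
        linarith
      · intro h5
        by_contra h6
        rw [abs_of_nonneg (by linarith : 0 ≤ g u - g v)] at h
        linarith
    simp [rankInd_eq, this]

theorem ofReal_sq_integral_sub_le {U : Type*} [MeasurableSpace U] {Q : Measure U}
    [IsProbabilityMeasure Q] {f f' : U → ℝ} (hf : Measurable f) (hf' : Measurable f')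
    (hb : ∀ v, |f v| ≤ 1) (hb' : ∀ v, |f' v| ≤ 1) {S : Set U} (hS : MeasurableSet S)
    (h : ∀ v, |f v - f' v| ≤ S.indicator 1 v) :
    ENNReal.ofReal ((∫ v, f v ∂Q - ∫ v, f' v ∂Q) ^ 2) ≤ Q S ^ 2 := by
  rw [← integral_sub (integrable_of_abs_le hf hb) (integrable_of_abs_le hf' hb'),
    ← ofReal_measureReal, ← ENNReal.ofReal_pow measureReal_nonneg, ← sq_abs]
  refine ENNReal.ofReal_le_ofReal (pow_le_pow_left₀ (abs_nonneg _) ?_ 2)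
  rw [← integral_indicator_one hS]
  refine (abs_integral_le_integral_abs).trans (integral_mono_of_nonneg
    (ae_of_all _ fun v => abs_nonneg _) ?_ (ae_of_all _ h))
  exact (integrable_const (1 : ℝ)).indicator hS

theorem measurable_perturb {X L : Type*} [MeasurableSpace X] [MeasurableSpace L]
    {Dhat : Distinguisher X L} {n : ℕ}
    (hD : Measurable fun p : (Fin n → X × L × L) × (X × L) => Dhat n p.1 p.2) (i : Fin n) :
    Measurable (perturb Dhat n i) :=
  (hD.comp (measurable_fst.prodMk measurable_snd.snd)).sub
    (hD.comp ((measurable_update'.comp (measurable_fst.prodMk measurable_snd.fst)).prodMk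
      measurable_snd.snd))

theorem measurable_perturb_assoc {X L : Type*} [MeasurableSpace X] [MeasurableSpace L]
    {Dhat : Distinguisher X L} {n : ℕ}
    (hD : Measurable fun p : (Fin n → X × L × L) × (X × L) => Dhat n p.1 p.2) (i : Fin n) :
    Measurable fun q : ((Fin n → X × L × L) × (X × L × L)) × (X × L) =>
      ENNReal.ofReal ((Dhat n q.1.1 q.2 - Dhat n (Function.update q.1.1 i q.1.2) q.2) ^ 2) :=
  ((measurable_perturb hD i).pow_const 2).ennreal_ofReal.comp
    (measurable_fst.fst.prodMk (measurable_fst.snd.prodMk measurable_snd))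

/-- Reassociates the product: stability groups the replacement triplet with the evaluation point,
Efron–Stein groups it with the data. -/
theorem lintegral_sq_perturb_le {X L : Type*} [MeasurableSpace X] [MeasurableSpace L]
    {Dhat : Distinguisher X L} {n : ℕ}
    (hD : Measurable fun p : (Fin n → X × L × L) × (X × L) => Dhat n p.1 p.2)
    {N : Measure (Fin n → X × L × L)} {P : Measure (X × L × L)} {Q : Measure (X × L)}
    [IsProbabilityMeasure N] [IsProbabilityMeasure P] [IsProbabilityMeasure Q]
    {κ β : ℝ} (hκ : 0 < κ) (hβ : 0 < β) {i : Fin n}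
    (hQ : IsSubWeibull (N.prod (P.prod Q)) (perturb Dhat n i) κ β) :
    ∫⁻ p, ∫⁻ u, ENNReal.ofReal
        ((Dhat n p.1 u - Dhat n (Function.update p.1 i p.2) u) ^ 2) ∂Q ∂(N.prod P)
      ≤ ENNReal.ofReal (4 * β * Real.Gamma (2 * β) * κ ^ 2) := by
  have hpert := measurable_perturb hD i
  refine le_trans (le_of_eq ?_) (lintegral_sq_le_of_isSubWeibull hpert hκ hβ hQ)
  have hm := (hpert.pow_const 2).ennreal_ofReal
  rw [lintegral_prod _ hm.aemeasurable,
    lintegral_prod _ (measurable_perturb_assoc hD i).lintegral_prod_right'.aemeasurable]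
  refine lintegral_congr fun D => ?_
  exact (lintegral_prod _ (hm.comp measurable_prodMk_left).aemeasurable).symm

/-! ### From stability of the scores to stability of the projections -/

section Stability

variable {X L : Type*} [MeasurableSpace X] [Fintype L] [MeasurableSpace L]
  (PX : Measure X) [IsProbabilityMeasure PX] (η ηhat : Classifier X L)

theorem ofReal_add_sq_le (x y : ℝ) : ENNReal.ofReal ((x + y) ^ 2)
    ≤ 2 * (ENNReal.ofReal (x ^ 2) + ENNReal.ofReal (y ^ 2)) := by
  rw [← ENNReal.ofReal_add (sq_nonneg _) (sq_nonneg _), ← ENNReal.ofReal_ofNat 2,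
    ← ENNReal.ofReal_mul (by norm_num)]
  exact ENNReal.ofReal_le_ofReal (add_sq_le)

/-- φ integrates out the second-sample point and ψ the first-sample point, so the neighbour estimate
is applied once in each order of the two laws; 512 = 2 (128 + 128). -/
theorem lintegral_sq_proj_sub_le {g g' : X × L → ℝ} (hg : Measurable g) (hg' : Measurable g')
    {B : ℝ≥0} (hd : HasDensityBoundedBy ((pairLaw PX η).map g) B)
    (hd' : HasDensityBoundedBy ((pairLaw PX ηhat).map g) B) :
    ∫⁻ z, ENNReal.ofReal ((proj PX η ηhat g z - proj PX η ηhat g' z) ^ 2) ∂(tripleLaw PX η ηhat)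
      ≤ 512 * (B : ℝ≥0∞) ^ 2 * (∫⁻ u, ENNReal.ofReal ((g u - g' u) ^ 2) ∂(pairLaw PX η)
        + ∫⁻ u, ENNReal.ofReal ((g u - g' u) ^ 2) ∂(pairLaw PX ηhat)) := by
  set δ : X × L → ℝ := fun u => |g u - g' u| with hδ
  have hδm : Measurable δ := (hg.sub hg').abs
  have hδ0 : ∀ u, 0 ≤ δ u := fun u => abs_nonneg _
  have hδsq : ∀ u, (g u - g' u) ^ 2 = δ u ^ 2 := fun u => (sq_abs _).symm
  have hS : MeasurableSet {p : (X × L) × (X × L) | |g p.1 - g p.2| ≤ δ p.1 + δ p.2} :=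
    measurableSet_le ((hg.comp measurable_fst).sub (hg.comp measurable_snd)).abs
      ((hδm.comp measurable_fst).add (hδm.comp measurable_snd))
  have hr : ∀ {f : X × L → ℝ}, Measurable f →
      Measurable fun p : (X × L) × (X × L) => rankInd f p.1 p.2 := fun {f} hf =>
    (measurable_rankInd (A := Unit) (G := fun _ => f) (hf.comp measurable_snd)).comp
      (measurable_prodMk_left (x := ()))
  have hpm : ∀ {f : X × L → ℝ}, Measurable f → Measurable (phi PX ηhat f) := fun {f} hf =>
    (measurable_phi PX ηhat (A := Unit) (G := fun _ => f) (hf.comp measurable_snd)).comp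
      (measurable_prodMk_left (x := ()))
  have hqm : ∀ {f : X × L → ℝ}, Measurable f → Measurable (psi PX η f) := fun {f} hf =>
    (measurable_psi PX η (A := Unit) (G := fun _ => f) (hf.comp measurable_snd)).comp
      (measurable_prodMk_left (x := ()))
  have h1 : ∀ u, ENNReal.ofReal ((phi PX ηhat g u - phi PX ηhat g' u) ^ 2)
      ≤ pairLaw PX ηhat {v | |g u - g v| ≤ δ u + δ v} ^ 2 := fun u =>
    ofReal_sq_integral_sub_le ((hr hg).comp measurable_prodMk_left)
      ((hr hg').comp measurable_prodMk_left) (fun v => abs_rankInd_le _ _ _)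
      (fun v => abs_rankInd_le _ _ _) (measurable_prodMk_left hS)
      fun v => abs_rankInd_sub_le g g' u v
  have h2 : ∀ v, ENNReal.ofReal ((psi PX η g v - psi PX η g' v) ^ 2)
      ≤ pairLaw PX η {u | |g v - g u| ≤ δ v + δ u} ^ 2 := fun v => by
    have e : {u | |g v - g u| ≤ δ v + δ u} = {u | |g u - g v| ≤ δ u + δ v} := by
      ext u; simp only [Set.mem_ofPred_eq]; rw [abs_sub_comm, add_comm]
    rw [e]
    exact ofReal_sq_integral_sub_le ((hr hg).comp measurable_prodMk_right)
      ((hr hg').comp measurable_prodMk_right) (fun v => abs_rankInd_le _ _ _)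
      (fun v => abs_rankInd_le _ _ _) (measurable_prodMk_right hS)
      fun u => abs_rankInd_sub_le g g' u v
  have hB := hd.measure_abs_sub_le hg
  have hB' := hd'.measure_abs_sub_le hg
  have m1 : Measurable fun u => ENNReal.ofReal ((phi PX ηhat g u - phi PX ηhat g' u) ^ 2) :=
    (((hpm hg).sub (hpm hg')).pow_const 2).ennreal_ofReal
  have m2 : Measurable fun u => ENNReal.ofReal ((psi PX η g u - psi PX η g' u) ^ 2) :=
    (((hqm hg).sub (hqm hg')).pow_const 2).ennreal_ofReal
  simp_rw [hδsq]
  calc ∫⁻ z, ENNReal.ofReal ((proj PX η ηhat g z - proj PX η ηhat g' z) ^ 2)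
        ∂(tripleLaw PX η ηhat)
      ≤ ∫⁻ z, 2 * (ENNReal.ofReal ((phi PX ηhat g (fstPt z) - phi PX ηhat g' (fstPt z)) ^ 2)
          + ENNReal.ofReal ((psi PX η g (sndPt z) - psi PX η g' (sndPt z)) ^ 2))
          ∂(tripleLaw PX η ηhat) := by
        refine lintegral_mono fun z => ?_
        rw [show proj PX η ηhat g z - proj PX η ηhat g' z
          = (phi PX ηhat g (fstPt z) - phi PX ηhat g' (fstPt z))
            + (psi PX η g (sndPt z) - psi PX η g' (sndPt z)) by unfold proj; ring]
        exact ofReal_add_sq_le _ _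
    _ = 2 * (∫⁻ u, ENNReal.ofReal ((phi PX ηhat g u - phi PX ηhat g' u) ^ 2) ∂(pairLaw PX η)
          + ∫⁻ u, ENNReal.ofReal ((psi PX η g u - psi PX η g' u) ^ 2) ∂(pairLaw PX ηhat)) := by
        rw [lintegral_const_mul' _ _ (by norm_num), lintegral_add_left
            (f := fun z => ENNReal.ofReal ((phi PX ηhat g (fstPt z) - phi PX ηhat g' (fstPt z)) ^ 2))
            (m1.comp measurable_fstPt), (measurePreserving_fstPt PX η ηhat).lintegral_comp m1,
          (measurePreserving_sndPt PX η ηhat).lintegral_comp m2]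
    _ ≤ 2 * (128 * (B : ℝ≥0∞) ^ 2 * (∫⁻ u, ENNReal.ofReal (δ u ^ 2) ∂(pairLaw PX η)
            + ∫⁻ u, ENNReal.ofReal (δ u ^ 2) ∂(pairLaw PX ηhat))
          + 128 * (B : ℝ≥0∞) ^ 2 * (∫⁻ u, ENNReal.ofReal (δ u ^ 2) ∂(pairLaw PX ηhat)
            + ∫⁻ u, ENNReal.ofReal (δ u ^ 2) ∂(pairLaw PX η))) := by
        gcongr
        · exact (lintegral_mono h1).trans (lintegral_sq_measure_near_le hg hδm hδ0 hB hB')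
        · exact (lintegral_mono h2).trans (lintegral_sq_measure_near_le hg hδm hδ0 hB' hB)
    _ = _ := by
        rw [add_comm (∫⁻ u, ENNReal.ofReal (δ u ^ 2) ∂(pairLaw PX ηhat)), ← two_mul,
          ← mul_assoc, ← mul_assoc, ← mul_assoc]
        norm_num

/-- The mean of the projection over the fitting data. -/
noncomputable def meanProj (Dhat : Distinguisher X L) (n : ℕ) (z : X × L × L) : ℝ :=
  ∫ D, proj PX η ηhat (Dhat n D) z ∂(Measure.pi fun _ => tripleLaw PX η ηhat)

theorem measurable_sq_proj_sub_update {Dhat : Distinguisher X L} {n : ℕ}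
    (hD : Measurable fun p : (Fin n → X × L × L) × (X × L) => Dhat n p.1 p.2) (i : Fin n) :
    Measurable fun p : ((Fin n → X × L × L) × (X × L × L)) × (X × L × L) =>
      ENNReal.ofReal ((proj PX η ηhat (Dhat n p.1.1) p.2
        - proj PX η ηhat (Dhat n (Function.update p.1.1 i p.1.2)) p.2) ^ 2) :=
  have hp := measurable_proj PX η ηhat hD
  (((hp.comp (measurable_fst.fst.prodMk measurable_snd)).sub
    (hp.comp ((measurable_update'.comp measurable_fst).prodMk measurable_snd))).pow_const
      2).ennreal_ofReal

/-- Fubini puts the evaluation triplet innermost, so that the two neighbouring fits are frozen and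
can be compared as fixed scores; 4096 = 512 · 2 · 4. -/
theorem lintegral_sq_proj_sub_update_le {Dhat : Distinguisher X L} {n : ℕ}
    (hD : Measurable fun p : (Fin n → X × L × L) × (X × L) => Dhat n p.1 p.2)
    {B : ℝ≥0} (hd : ∀ D, HasDensityBoundedBy ((pairLaw PX η).map (Dhat n D)) B ∧
      HasDensityBoundedBy ((pairLaw PX ηhat).map (Dhat n D)) B)
    {N : Measure (Fin n → X × L × L)} {P : Measure (X × L × L)}
    [IsProbabilityMeasure N] [IsProbabilityMeasure P]
    {κ β : ℝ} (hκ : 0 < κ) (hβ : 0 < β) {i : Fin n}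
    (hs : IsSubWeibull (N.prod (P.prod (pairLaw PX η))) (perturb Dhat n i) κ β)
    (hs' : IsSubWeibull (N.prod (P.prod (pairLaw PX ηhat))) (perturb Dhat n i) κ β) :
    ∫⁻ z, ∫⁻ p, ENNReal.ofReal ((proj PX η ηhat (Dhat n p.1) z
          - proj PX η ηhat (Dhat n (Function.update p.1 i p.2)) z) ^ 2) ∂(N.prod P)
        ∂(tripleLaw PX η ηhat)
      ≤ ENNReal.ofReal (4096 * B ^ 2 * β * Real.Gamma (2 * β) * κ ^ 2) := by
  have hj := measurable_sq_proj_sub_update PX η ηhat hD i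
  have hG0 : 0 ≤ Real.Gamma (2 * β) := Real.Gamma_nonneg_of_nonneg (by positivity)
  have hDm : ∀ D, Measurable (Dhat n D) := fun D => hD.comp measurable_prodMk_left
  calc ∫⁻ z, ∫⁻ p, ENNReal.ofReal ((proj PX η ηhat (Dhat n p.1) z
          - proj PX η ηhat (Dhat n (Function.update p.1 i p.2)) z) ^ 2) ∂(N.prod P)
          ∂(tripleLaw PX η ηhat)
      = ∫⁻ p, ∫⁻ z, ENNReal.ofReal ((proj PX η ηhat (Dhat n p.1) z
          - proj PX η ηhat (Dhat n (Function.update p.1 i p.2)) z) ^ 2) ∂(tripleLaw PX η ηhat)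
          ∂(N.prod P) :=
        (lintegral_prod_symm _ hj.aemeasurable).symm.trans (lintegral_prod _ hj.aemeasurable)
    _ ≤ ∫⁻ p, 512 * (B : ℝ≥0∞) ^ 2 * (∫⁻ u, ENNReal.ofReal
          ((Dhat n p.1 u - Dhat n (Function.update p.1 i p.2) u) ^ 2) ∂(pairLaw PX η)
        + ∫⁻ u, ENNReal.ofReal
          ((Dhat n p.1 u - Dhat n (Function.update p.1 i p.2) u) ^ 2) ∂(pairLaw PX ηhat))
          ∂(N.prod P) :=
        lintegral_mono fun p => lintegral_sq_proj_sub_le PX η ηhat (hDm _) (hDm _)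
          (hd _).1 (hd _).2
    _ = 512 * (B : ℝ≥0∞) ^ 2 * (∫⁻ p, ∫⁻ u, ENNReal.ofReal
          ((Dhat n p.1 u - Dhat n (Function.update p.1 i p.2) u) ^ 2)
            ∂(pairLaw PX η) ∂(N.prod P)
        + ∫⁻ p, ∫⁻ u, ENNReal.ofReal
          ((Dhat n p.1 u - Dhat n (Function.update p.1 i p.2) u) ^ 2)
            ∂(pairLaw PX ηhat) ∂(N.prod P)) := by
        rw [lintegral_const_mul' _ _ (by finiteness), lintegral_add_left]
        exact (measurable_perturb_assoc hD i).lintegral_prod_right'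
    _ ≤ 512 * (B : ℝ≥0∞) ^ 2 * (ENNReal.ofReal (4 * β * Real.Gamma (2 * β) * κ ^ 2)
        + ENNReal.ofReal (4 * β * Real.Gamma (2 * β) * κ ^ 2)) := by
        gcongr
        · exact lintegral_sq_perturb_le hD hκ hβ hs
        · exact lintegral_sq_perturb_le hD hκ hβ hs'
    _ = _ := by
        rw [← ENNReal.ofReal_add (by positivity) (by positivity), ← ENNReal.ofReal_coe_nnreal,
          ← ENNReal.ofReal_ofNat 512, ← ENNReal.ofReal_pow B.coe_nonneg,
          ← ENNReal.ofReal_mul (by norm_num), ← ENNReal.ofReal_mul (by positivity)]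
        congr 1
        ring

/-- Efron–Stein in the fitting data, applied for each fixed evaluation triplet `z` and then
integrated over `z`. -/
theorem lintegral_sq_proj_sub_meanProj_le {Dhat : Distinguisher X L} {n : ℕ}
    (hD : Measurable fun p : (Fin n → X × L × L) × (X × L) => Dhat n p.1 p.2)
    {B : ℝ≥0} (hd : ∀ D, HasDensityBoundedBy ((pairLaw PX η).map (Dhat n D)) B ∧
      HasDensityBoundedBy ((pairLaw PX ηhat).map (Dhat n D)) B)
    {κ β : ℝ} (hκ : 0 < κ) (hβ : 0 < β)
    (hs : ∀ i : Fin n, IsSubWeibull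
      ((Measure.pi fun _ : Fin n => tripleLaw PX η ηhat).prod
        ((tripleLaw PX η ηhat).prod (pairLaw PX η))) (perturb Dhat n i) κ β ∧
      IsSubWeibull
      ((Measure.pi fun _ : Fin n => tripleLaw PX η ηhat).prod
        ((tripleLaw PX η ηhat).prod (pairLaw PX ηhat))) (perturb Dhat n i) κ β) :
    ∫⁻ z, ∫⁻ D, ENNReal.ofReal ((proj PX η ηhat (Dhat n D) z - meanProj PX η ηhat Dhat n z) ^ 2)
        ∂(Measure.pi fun _ => tripleLaw PX η ηhat) ∂(tripleLaw PX η ηhat)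
      ≤ ENNReal.ofReal (4096 * B ^ 2 * β * Real.Gamma (2 * β) * (n * κ ^ 2)) := by
  set P := tripleLaw PX η ηhat with hP
  set N : Measure (Fin n → X × L × L) := Measure.pi fun _ => P with hN
  have hG0 : 0 ≤ Real.Gamma (2 * β) := Real.Gamma_nonneg_of_nonneg (by positivity)
  calc ∫⁻ z, ∫⁻ D, ENNReal.ofReal
        ((proj PX η ηhat (Dhat n D) z - meanProj PX η ηhat Dhat n z) ^ 2) ∂N ∂P
      ≤ ∫⁻ z, ∑ i : Fin n, ∫⁻ p, ENNReal.ofReal ((proj PX η ηhat (Dhat n p.1) z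
          - proj PX η ηhat (Dhat n (Function.update p.1 i p.2)) z) ^ 2) ∂(N.prod P) ∂P :=
        lintegral_mono fun z =>
          lintegral_sq_sub_le_sum_update P (f := fun D => proj PX η ηhat (Dhat n D) z)
            ((measurable_proj PX η ηhat hD).comp measurable_prodMk_right)
            fun D => abs_proj_le PX η ηhat _ z
    _ = ∑ i : Fin n, ∫⁻ z, ∫⁻ p, ENNReal.ofReal ((proj PX η ηhat (Dhat n p.1) z
          - proj PX η ηhat (Dhat n (Function.update p.1 i p.2)) z) ^ 2) ∂(N.prod P) ∂P := by
        refine lintegral_finsetSum _ fun i _ => ?_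
        exact (measurable_sq_proj_sub_update PX η ηhat hD i).lintegral_prod_left'
    _ ≤ ∑ i : Fin n, ENNReal.ofReal (4096 * B ^ 2 * β * Real.Gamma (2 * β) * κ ^ 2) :=
        Finset.sum_le_sum fun i _ =>
          lintegral_sq_proj_sub_update_le PX η ηhat hD hd hκ hβ (hs i).1 (hs i).2
    _ = _ := by
        rw [Finset.sum_const, Finset.card_univ, Fintype.card_fin, nsmul_eq_mul,
          ← ENNReal.ofReal_natCast, ← ENNReal.ofReal_mul (by positivity)]
        congr 1
        ring

theorem tendsto_lintegral_sq_proj_sub_meanProj {K : ℕ} {Dhat : Distinguisher X L}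
    (hD : ∀ n, Measurable fun p : (Fin n → X × L × L) × (X × L) => Dhat n p.1 p.2)
    (hA : Assumption K PX η ηhat Dhat) :
    Tendsto (fun n => ∫⁻ z, ∫⁻ D,
        ENNReal.ofReal ((proj PX η ηhat (Dhat n D) z - meanProj PX η ηhat Dhat n z) ^ 2)
        ∂(Measure.pi fun _ => tripleLaw PX η ηhat) ∂(tripleLaw PX η ηhat)) atTop (nhds 0) := by
  obtain ⟨B, -, hB⟩ := hA.density
  obtain ⟨β, hβ, hs⟩ := hA.stability
  set C : ℝ := 4096 * B ^ 2 * β * Real.Gamma (2 * β) with hC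
  have hlim : Tendsto (fun n : ℕ => ENNReal.ofReal (C * Real.log n ^ (-(2 * β)))) atTop
      (nhds 0) := by
    have h1 : Tendsto (fun n : ℕ => Real.log n ^ (-(2 * β))) atTop (nhds 0) :=
      (tendsto_rpow_neg_atTop (by positivity)).comp
        (Real.tendsto_log_atTop.comp tendsto_natCast_atTop_atTop)
    simpa using ENNReal.tendsto_ofReal (h1.const_mul C)
  refine tendsto_of_tendsto_of_tendsto_of_le_of_le' tendsto_const_nhds hlim
    (Eventually.of_forall fun _ => zero_le) ?_
  filter_upwards [eventually_ge_atTop 2] with n hn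
  have hlog : 0 < Real.log n := Real.log_pos (by exact_mod_cast hn)
  have hn0 : (0 : ℝ) < n := by exact_mod_cast (by omega : 0 < n)
  refine (lintegral_sq_proj_sub_meanProj_le PX η ηhat (hD n) (hB n (by omega))
    (κ := Real.log n ^ (-β) * (n : ℝ) ^ (-(1 / 2 : ℝ))) (by positivity) hβ (hs n hn)).trans
      (le_of_eq ?_)
  -- The factor n^(-1/2) squared cancels the number of coordinates exactly; convergence to 0 comes
  -- from the logarithm alone.
  have e : (n : ℝ) * (Real.log n ^ (-β) * (n : ℝ) ^ (-(1 / 2 : ℝ))) ^ 2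
      = Real.log n ^ (-(2 * β)) := by
    rw [mul_pow, ← Real.rpow_natCast (Real.log n ^ (-β)), ← Real.rpow_mul hlog.le,
      ← Real.rpow_natCast ((n : ℝ) ^ (-(1 / 2 : ℝ))), ← Real.rpow_mul hn0.le]
    norm_num
    rw [Real.rpow_neg_one, mul_comm, mul_assoc, inv_mul_cancel₀ hn0.ne', mul_one, mul_comm]
  rw [e]

end Stability

/-! ### Comparison of variances -/

theorem variance_eq_of_abs_le {α : Type*} [MeasurableSpace α] {μ : Measure α}
    [IsProbabilityMeasure μ] {f : α → ℝ} (hf : Measurable f) {C : ℝ} (h : ∀ x, |f x| ≤ C) :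
    Var[f; μ] = ∫ x, f x ^ 2 ∂μ - (∫ x, f x ∂μ) ^ 2 := by
  rw [variance_eq_sub (MemLp.of_bound hf.aestronglyMeasurable C (ae_of_all _ h))]
  rfl

/-- With a, b the two means, Var f - Var g = ∫ (f - g)(f + g - (a + b)). The second factor is at
most 4C in absolute value, and Jensen concludes. -/
theorem sq_variance_sub_le {α : Type*} [MeasurableSpace α] {μ : Measure α}
    [IsProbabilityMeasure μ] {f g : α → ℝ} (hf : Measurable f) (hg : Measurable g) {C : ℝ}
    (h : ∀ x, |f x| ≤ C) (h' : ∀ x, |g x| ≤ C) :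
    (Var[f; μ] - Var[g; μ]) ^ 2 ≤ (4 * C) ^ 2 * ∫ x, (f x - g x) ^ 2 ∂μ := by
  rw [variance_eq_of_abs_le hf h, variance_eq_of_abs_le hg h']
  set a := ∫ x, f x ∂μ with ha
  set b := ∫ x, g x ∂μ with hb
  have ha' : |a| ≤ C := abs_integral_le_of_abs_le h
  have hb' : |b| ≤ C := abs_integral_le_of_abs_le h'
  have sq : ∀ {x : ℝ}, |x| ≤ C → |x ^ 2| ≤ C ^ 2 := fun {x} hx => by
    rw [abs_pow]; exact pow_le_pow_left₀ (abs_nonneg _) hx 2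
  have if2 : Integrable (fun x => f x ^ 2) μ :=
    integrable_of_abs_le (hf.pow_const 2) fun x => sq (h x)
  have ig2 : Integrable (fun x => g x ^ 2) μ :=
    integrable_of_abs_le (hg.pow_const 2) fun x => sq (h' x)
  have hk : ∀ x, |f x + g x - (a + b)| ≤ 4 * C := fun x => by
    have h1 := abs_le.1 (h x)
    have h2 := abs_le.1 (h' x)
    have h3 := abs_le.1 ha'
    have h4 := abs_le.1 hb'
    rw [abs_le]; constructor <;> linarith
  have hfg : ∀ x, |f x - g x| ≤ 2 * C := fun x =>
    (abs_sub _ _).trans (by linarith [h x, h' x])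
  have e : ∫ x, f x ^ 2 ∂μ - a ^ 2 - (∫ x, g x ^ 2 ∂μ - b ^ 2)
      = ∫ x, (f x - g x) * (f x + g x - (a + b)) ∂μ := by
    have e1 : ∀ x, (f x - g x) * (f x + g x - (a + b))
        = (f x ^ 2 - g x ^ 2) - (a + b) * (f x - g x) := fun x => by ring
    simp_rw [e1]
    have i1 : Integrable (fun x => f x ^ 2 - g x ^ 2) μ := if2.sub ig2
    have i3 := integrable_of_abs_le (μ := μ) hf h
    have i4 := integrable_of_abs_le (μ := μ) hg h'
    have i2 : Integrable (fun x => (a + b) * (f x - g x)) μ := (i3.sub i4).const_mul _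
    rw [integral_sub i1 i2, integral_sub if2 ig2, integral_const_mul, integral_sub i3 i4,
      ← ha, ← hb]
    ring
  have hm : Measurable fun x => (f x - g x) * (f x + g x - (a + b)) :=
    (hf.sub hg).mul ((hf.add hg).sub_const _)
  have hC : 0 ≤ C := (abs_nonneg _).trans ha'
  have hmb : ∀ x, |(f x - g x) * (f x + g x - (a + b))| ≤ (2 * C) * (4 * C) := fun x => by
    rw [abs_mul]
    exact mul_le_mul (hfg x) (hk x) (abs_nonneg _) (by positivity)
  rw [e, ← integral_const_mul]
  refine (sq_integral_le hm hmb).trans (integral_mono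
    (integrable_of_abs_le (hm.pow_const 2) (C := ((2 * C) * (4 * C)) ^ 2) fun x => by
      rw [abs_pow]; exact pow_le_pow_left₀ (abs_nonneg _) (hmb x) 2)
    ((integrable_of_abs_le ((hf.sub hg).pow_const 2) (C := (2 * C) ^ 2) fun x => by
      rw [abs_pow]; exact pow_le_pow_left₀ (abs_nonneg _) (hfg x) 2).const_mul _) fun x => ?_)
  dsimp only
  rw [mul_pow, mul_comm]
  refine mul_le_mul_of_nonneg_right ?_ (sq_nonneg _)
  rw [← sq_abs]
  exact pow_le_pow_left₀ (abs_nonneg _) (hk x) 2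

/-! ### Second moments on one fold -/

section Centered

variable {ι α : Type*} [Fintype ι] [DecidableEq ι] [MeasurableSpace α] {P : Measure α}
  [IsProbabilityMeasure P] {ξ : (ι → α) → α → α → ℝ} {c : ℝ} {I : Finset ι}

/-- Integrate coordinate `l` first: neither the function `ξ z` nor the first factor depends on it,
and the second factor has mean zero in it. -/
theorem integral_mul_eq_zero_of_centered
    (hξ : Measurable fun p : (ι → α) × α × α => ξ p.1 p.2.1 p.2.2)
    (hc : ∀ z a b, |ξ z a b| ≤ c)
    (hinv : ∀ z, ∀ l ∈ I, ∀ w, ξ (Function.update z l w) = ξ z)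
    (hzero : ∀ z a, ∫ w, ξ z a w ∂P = 0) {i j l : ι} (hl : l ∈ I) (hil : i ≠ l) (hjl : j ≠ l) :
    ∫ z, ξ z (z i) (z j) * ξ z (z i) (z l) ∂(Measure.pi fun _ => P) = 0 := by
  have hm : ∀ j, Measurable fun z : ι → α => ξ z (z i) (z j) := fun j =>
    hξ.comp (measurable_id.prodMk ((measurable_pi_apply i).prodMk (measurable_pi_apply j)))
  rw [integral_pi_update P l (G := fun z => ξ z (z i) (z j) * ξ z (z i) (z l))
    ((hm j).mul (hm l)) (C := c * c) fun z => by
    rw [abs_mul]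
    exact mul_le_mul (hc _ _ _) (hc _ _ _) (abs_nonneg _) ((abs_nonneg _).trans (hc z (z i) (z i)))]
  simp only [hinv _ l hl, Function.update_of_ne hil, Function.update_of_ne hjl,
    Function.update_self, integral_const_mul, hzero, mul_zero, integral_zero]

/-- Averages of conditionally centred, conditionally independent variables are small. -/
theorem integral_sq_average_le_of_centered
    (hξ : Measurable fun p : (ι → α) × α × α => ξ p.1 p.2.1 p.2.2)
    (hc : ∀ z a b, |ξ z a b| ≤ c)
    (hinv : ∀ z, ∀ l ∈ I, ∀ w, ξ (Function.update z l w) = ξ z)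
    (hzero : ∀ z a, ∫ w, ξ z a w ∂P = 0) (hI : 0 < I.card) (i : ι) :
    ∫ z, (1 / (I.card : ℝ) * ∑ j ∈ I, ξ z (z i) (z j)) ^ 2 ∂(Measure.pi fun _ => P)
      ≤ c ^ 2 / (I.card : ℝ) := by
  have hm : ∀ j, Measurable fun z : ι → α => ξ z (z i) (z j) := fun j =>
    hξ.comp (measurable_id.prodMk ((measurable_pi_apply i).prodMk (measurable_pi_apply j)))
  have hb : ∀ j l (z : ι → α), |ξ z (z i) (z j) * ξ z (z i) (z l)| ≤ c * c := fun j l z => by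
    rw [abs_mul]
    exact mul_le_mul (hc _ _ _) (hc _ _ _) (abs_nonneg _) ((abs_nonneg _).trans (hc z (z i) (z i)))
  have hint : ∀ j l, Integrable (fun z : ι → α => ξ z (z i) (z j) * ξ z (z i) (z l))
      (Measure.pi fun _ => P) := fun j l => integrable_of_abs_le ((hm j).mul (hm l)) (hb j l)
  have e : ∀ z : ι → α, (1 / (I.card : ℝ) * ∑ j ∈ I, ξ z (z i) (z j)) ^ 2
      = (1 / (I.card : ℝ)) ^ 2 * ∑ j ∈ I, ∑ l ∈ I, ξ z (z i) (z j) * ξ z (z i) (z l) :=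
    fun z => by rw [mul_pow, sq (∑ j ∈ I, ξ z (z i) (z j)), Finset.sum_mul_sum]
  simp_rw [e]
  rw [integral_const_mul, integral_finsetSum _ fun j _ => integrable_finsetSum _ fun l _ => hint j l]
  simp_rw [integral_finsetSum I fun l _ => hint _ l]
  have hle : ∀ j ∈ I, ∀ l ∈ I,
      ∫ z, ξ z (z i) (z j) * ξ z (z i) (z l) ∂(Measure.pi fun _ => P)
        ≤ if j = l then c * c else 0 := by
    intro j hj l hl
    split_ifs with h
    · exact (abs_le.1 (abs_integral_le_of_abs_le (hb j l))).2
    -- The self-pair ξ(z_i, z_i) need not be centred. But of two distinct indices at most one equals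
    -- `i`, and the other can be integrated out, so only diagonal terms survive.
    · by_cases hil : i = l
      · have hij : i ≠ j := fun h' => h (h'.symm.trans hil)
        refine le_of_eq ?_
        simp_rw [fun z : ι → α => mul_comm (ξ z (z i) (z j))]
        exact integral_mul_eq_zero_of_centered hξ hc hinv hzero hj hij fun h' => h h'.symm
      · exact (integral_mul_eq_zero_of_centered hξ hc hinv hzero hl hil h).le
  have hI0 : (0 : ℝ) < I.card := by exact_mod_cast hI
  calc (1 / (I.card : ℝ)) ^ 2 * ∑ j ∈ I, ∑ l ∈ I,
        ∫ z, ξ z (z i) (z j) * ξ z (z i) (z l) ∂(Measure.pi fun _ => P)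
      ≤ (1 / (I.card : ℝ)) ^ 2 * ∑ j ∈ I, ∑ l ∈ I, (if j = l then c * c else 0) := by
        gcongr with j hj l hl
        exact hle j hj l hl
    _ = c ^ 2 / I.card := by
        have : ∀ j ∈ I, ∑ l ∈ I, (if j = l then c * c else 0) = c * c := fun j hj => by
          rw [Finset.sum_ite_eq, if_pos hj]
        rw [Finset.sum_congr rfl this, Finset.sum_const, nsmul_eq_mul]
        field_simp

end Centered

/-- Deterministic comparison. A variance depends on the first two moments, and on [0, 2] these move
by at most multiples of the mean error `S` between `a` and `h` and of the sampling errors `r`, `q`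
of the moments of `h`. The last term pays for dividing by m - 1 instead of m. -/
theorem sq_sampleVariance_sub_le {ι : Type*} (I : Finset ι) (hI : 2 ≤ I.card) (a h : ι → ℝ)
    (ha : ∀ i ∈ I, a i ∈ Set.Icc (0 : ℝ) 2) (hh : ∀ i ∈ I, h i ∈ Set.Icc (0 : ℝ) 2) {M₁ M₂ : ℝ}
    (hM₁ : M₁ ∈ Set.Icc (0 : ℝ) 2) (hv : M₂ - M₁ ^ 2 ∈ Set.Icc (0 : ℝ) 4) :
    (1 / ((I.card : ℝ) - 1) * ∑ i ∈ I, (a i - 1 / (I.card : ℝ) * ∑ j ∈ I, a j) ^ 2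
        - (M₂ - M₁ ^ 2)) ^ 2
      ≤ 1024 * (1 / (I.card : ℝ) * ∑ i ∈ I, (a i - h i) ^ 2)
        + 16 * (1 / (I.card : ℝ) * ∑ i ∈ I, (h i ^ 2 - M₂)) ^ 2
        + 256 * (1 / (I.card : ℝ) * ∑ i ∈ I, (h i - M₁)) ^ 2 + 256 / (I.card : ℝ) := by
  set m : ℝ := (I.card : ℝ) with hm
  have hm2 : (2 : ℝ) ≤ m := by rw [hm]; exact_mod_cast hI
  have hm0 : 0 < m := by linarith
  have hm1 : 0 < m - 1 := by linarith
  set A := 1 / m * ∑ i ∈ I, a i with hA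
  set A₂ := 1 / m * ∑ i ∈ I, a i ^ 2 with hA₂
  set S := 1 / m * ∑ i ∈ I, |a i - h i| with hS
  set S₂ := 1 / m * ∑ i ∈ I, (a i - h i) ^ 2 with hS₂
  set q := 1 / m * ∑ i ∈ I, (h i ^ 2 - M₂) with hq
  set r := 1 / m * ∑ i ∈ I, (h i - M₁) with hr
  have hcard : ∀ x : ℝ, 1 / m * ∑ _i ∈ I, x = x := fun x => by
    rw [Finset.sum_const, nsmul_eq_mul, ← hm]; field_simp
  have e1 : 1 / (m - 1) * ∑ i ∈ I, (a i - A) ^ 2 = m / (m - 1) * (A₂ - A ^ 2) := by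
    have e2 : ∑ i ∈ I, a i = m * A := by rw [hA]; field_simp
    have e3 : ∑ i ∈ I, a i ^ 2 = m * A₂ := by rw [hA₂]; field_simp
    have e4 : ∑ i ∈ I, (a i - A) ^ 2 = m * (A₂ - A ^ 2) := by
      have : ∀ i, (a i - A) ^ 2 = a i ^ 2 - 2 * A * a i + A ^ 2 := fun i => by ring
      simp_rw [this]
      rw [Finset.sum_add_distrib, Finset.sum_sub_distrib, ← Finset.mul_sum, e2, e3,
        Finset.sum_const, nsmul_eq_mul, ← hm]
      ring
    rw [e4]; ring
  have hS0 : 0 ≤ S := by positivity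
  have hSS : S ^ 2 ≤ S₂ := by
    have h1 := sq_sum_le_card_mul_sum_sq (s := I) (f := fun i => |a i - h i|)
    simp only [sq_abs] at h1
    rw [hS, hS₂, mul_pow]
    calc (1 / m) ^ 2 * (∑ i ∈ I, |a i - h i|) ^ 2
        ≤ (1 / m) ^ 2 * (m * ∑ i ∈ I, (a i - h i) ^ 2) := by gcongr
      _ = _ := by field_simp
  have hAr : |A - M₁| ≤ S + |r| := by
    have : A - M₁ = 1 / m * ∑ i ∈ I, (a i - h i) + r := by
      rw [hr, ← mul_add, ← Finset.sum_add_distrib]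
      simp only [sub_add_sub_cancel]
      rw [Finset.sum_sub_distrib, mul_sub, hcard]
    rw [this]
    refine (abs_add_le _ _).trans (add_le_add ?_ le_rfl)
    rw [abs_mul, abs_of_pos (by positivity : 0 < 1 / m)]
    exact mul_le_mul_of_nonneg_left (Finset.abs_sum_le_sum_abs _ _) (by positivity)
  have hA2q : |A₂ - M₂| ≤ 4 * S + |q| := by
    have : A₂ - M₂ = 1 / m * ∑ i ∈ I, (a i ^ 2 - h i ^ 2) + q := by
      rw [hq, ← mul_add, ← Finset.sum_add_distrib]
      simp only [sub_add_sub_cancel]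
      rw [Finset.sum_sub_distrib, mul_sub, hcard]
    rw [this]
    refine (abs_add_le _ _).trans (add_le_add ?_ le_rfl)
    rw [abs_mul, abs_of_pos (by positivity : 0 < 1 / m), hS, mul_left_comm, Finset.mul_sum]
    refine mul_le_mul_of_nonneg_left ((Finset.abs_sum_le_sum_abs _ _).trans
      (Finset.sum_le_sum fun i hi => ?_)) (by positivity)
    rw [sq_sub_sq, abs_mul]
    refine mul_le_mul_of_nonneg_right ?_ (abs_nonneg _)
    rw [abs_le]
    constructor <;> linarith [(ha i hi).1, (ha i hi).2, (hh i hi).1, (hh i hi).2]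
  have hA02 : A ∈ Set.Icc (0 : ℝ) 2 := by
    constructor
    · exact mul_nonneg (by positivity) (Finset.sum_nonneg fun i hi => (ha i hi).1)
    · rw [← hcard 2]
      exact mul_le_mul_of_nonneg_left (Finset.sum_le_sum fun i hi => (ha i hi).2) (by positivity)
  have hsq : |A ^ 2 - M₁ ^ 2| ≤ 4 * (S + |r|) := by
    rw [sq_sub_sq, abs_mul]
    refine mul_le_mul ?_ hAr (abs_nonneg _) (by norm_num)
    rw [abs_le]
    constructor <;> linarith [hA02.1, hA02.2, hM₁.1, hM₁.2]
  set v := M₂ - M₁ ^ 2 with hvdef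
  have hD : |A₂ - A ^ 2 - v| ≤ 8 * S + |q| + 4 * |r| := by
    have : A₂ - A ^ 2 - v = (A₂ - M₂) - (A ^ 2 - M₁ ^ 2) := by rw [hvdef]; ring
    rw [this]
    exact (abs_sub _ _).trans (by linarith)
  have hrat : m / (m - 1) ≤ 2 := by rw [div_le_iff₀ hm1]; linarith
  have hrat' : 1 / (m - 1) ≤ 2 / m := by rw [div_le_div_iff₀ hm1 hm0]; linarith
  have hfin : |m / (m - 1) * (A₂ - A ^ 2) - v| ≤ 2 * (8 * S + |q| + 4 * |r|) + 8 / m := by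
    have : m / (m - 1) * (A₂ - A ^ 2) - v
        = m / (m - 1) * (A₂ - A ^ 2 - v) + 1 / (m - 1) * v := by field_simp; ring
    rw [this]
    refine (abs_add_le _ _).trans (add_le_add ?_ ?_)
    · rw [abs_mul, abs_of_pos (by positivity : 0 < m / (m - 1))]
      exact mul_le_mul hrat hD (abs_nonneg _) (by norm_num)
    · rw [abs_of_nonneg (mul_nonneg (by positivity) hv.1)]
      calc 1 / (m - 1) * v ≤ 2 / m * 4 :=
            mul_le_mul hrat' hv.2 hv.1 (by positivity)
        _ = 8 / m := by ring
  rw [e1, ← sq_abs]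
  have h8 : (8 / m) ^ 2 ≤ 64 / m := by
    rw [div_pow, div_le_div_iff₀ (by positivity) hm0]
    nlinarith
  -- (x + y + z + w)² ≤ 4 (x² + y² + z² + w²); the hints are the six squared pairwise differences.
  have h9 : (2 * (8 * S + |q| + 4 * |r|) + 8 / m) ^ 2
      ≤ 4 * (256 * S ^ 2 + 4 * |q| ^ 2 + 64 * |r| ^ 2 + (8 / m) ^ 2) := by
    nlinarith [sq_nonneg (16 * S - 2 * |q|), sq_nonneg (16 * S - 8 * |r|),
      sq_nonneg (16 * S - 8 / m), sq_nonneg (2 * |q| - 8 * |r|), sq_nonneg (2 * |q| - 8 / m),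
      sq_nonneg (8 * |r| - 8 / m)]
  rw [sq_abs, sq_abs] at h9
  have h10 : 4 * (64 / m) = 256 / m := by ring
  refine (pow_le_pow_left₀ (abs_nonneg _) hfin 2).trans (h9.trans ?_)
  linarith

section Fold

variable {X L ι : Type*} (g : X × L → ℝ) (z : ι → X × L × L) (I : Finset ι)

/-- Both empirical projections average to the same double sum, after exchanging its indices for ψ̂;
therefore `foldVar` is a genuine sample variance. -/
theorem average_empPhi_add_empPsi :
    1 / (I.card : ℝ) * ∑ i ∈ I, (empPhi g z I (fstPt (z i)) + empPsi g z I (sndPt (z i)))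
      = 2 * foldStat g z I := by
  have h1 : ∑ i ∈ I, empPhi g z I (fstPt (z i))
      = 1 / (I.card : ℝ) * ∑ i ∈ I, ∑ j ∈ I, rankInd g (fstPt (z i)) (sndPt (z j)) := by
    rw [Finset.mul_sum]; rfl
  have h2 : ∑ i ∈ I, empPsi g z I (sndPt (z i))
      = 1 / (I.card : ℝ) * ∑ i ∈ I, ∑ j ∈ I, rankInd g (fstPt (z i)) (sndPt (z j)) := by
    rw [Finset.sum_comm, Finset.mul_sum]; rfl
  rw [Finset.sum_add_distrib, h1, h2, foldStat]
  ring

theorem average_mem_Icc {f : ι → ℝ} (hI : 0 < I.card) {b : ℝ}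
    (h : ∀ i ∈ I, f i ∈ Set.Icc 0 b) : 1 / (I.card : ℝ) * ∑ i ∈ I, f i ∈ Set.Icc 0 b := by
  have hm : (0 : ℝ) < I.card := by exact_mod_cast hI
  refine ⟨mul_nonneg (by positivity) (Finset.sum_nonneg fun i hi => (h i hi).1), ?_⟩
  have := Finset.sum_le_card_nsmul I f b fun i hi => (h i hi).2
  rw [nsmul_eq_mul] at this
  rw [one_div, inv_mul_le_iff₀ hm]
  exact this

/-- The error of the symmetrised indicator around the projection at its first triplet. -/
noncomputable def projError [MeasurableSpace X] [Fintype L] [MeasurableSpace L] (PX : Measure X)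
    (η ηhat : Classifier X L) (a w : X × L × L) : ℝ :=
  rankInd g (fstPt a) (sndPt w) + rankInd g (fstPt w) (sndPt a) - proj PX η ηhat g a

theorem empPhi_add_empPsi_sub_proj [MeasurableSpace X] [Fintype L] [MeasurableSpace L]
    (PX : Measure X) (η ηhat : Classifier X L) (hI : 0 < I.card) (a : X × L × L) :
    empPhi g z I (fstPt a) + empPsi g z I (sndPt a) - proj PX η ηhat g a
      = 1 / (I.card : ℝ) * ∑ j ∈ I, projError g PX η ηhat a (z j) := by
  have hm : (0 : ℝ) < I.card := by exact_mod_cast hI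
  unfold projError
  rw [Finset.sum_sub_distrib, Finset.sum_add_distrib, Finset.sum_const, nsmul_eq_mul, empPhi,
    empPsi]
  field_simp

end Fold

/-! ### Mean-square error of one fold, with the score independent of the fold -/

section FoldMoments

variable {X L : Type*} [MeasurableSpace X] [Fintype L] [MeasurableSpace L]
  (PX : Measure X) [IsProbabilityMeasure PX] (η ηhat : Classifier X L)

theorem abs_projError_le (g : X × L → ℝ) (a w : X × L × L) :
    |projError g PX η ηhat a w| ≤ 2 := by
  have h1 := proj_mem_Icc PX η ηhat g a
  have h2 := rankInd_nonneg g (fstPt a) (sndPt w)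
  have h3 := rankInd_le_one g (fstPt a) (sndPt w)
  have h4 := rankInd_nonneg g (fstPt w) (sndPt a)
  have h5 := rankInd_le_one g (fstPt w) (sndPt a)
  unfold projError
  rw [abs_le]
  constructor <;> linarith [h1.1, h1.2]

theorem measurable_projError {A : Type*} [MeasurableSpace A] {G : A → X × L → ℝ}
    (hG : Measurable fun p : A × (X × L) => G p.1 p.2) :
    Measurable fun p : A × (X × L × L) × (X × L × L) =>
      projError (G p.1) PX η ηhat p.2.1 p.2.2 := by
  have hr := measurable_rankInd hG
  have h1 : Measurable fun p : A × (X × L × L) × (X × L × L) =>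
      (p.1, fstPt p.2.1, sndPt p.2.2) :=
    measurable_fst.prodMk ((measurable_fstPt.comp measurable_snd.fst).prodMk
      (measurable_sndPt.comp measurable_snd.snd))
  have h2 : Measurable fun p : A × (X × L × L) × (X × L × L) =>
      (p.1, fstPt p.2.2, sndPt p.2.1) :=
    measurable_fst.prodMk ((measurable_fstPt.comp measurable_snd.snd).prodMk
      (measurable_sndPt.comp measurable_snd.fst))
  have h3 : Measurable fun p : A × (X × L × L) × (X × L × L) => (p.1, p.2.1) :=
    measurable_fst.prodMk measurable_snd.fst
  exact ((hr.comp h1).add (hr.comp h2)).sub ((measurable_proj PX η ηhat hG).comp h3)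

theorem integral_projError {g : X × L → ℝ} (hg : Measurable g) (a : X × L × L) :
    ∫ w, projError g PX η ηhat a w ∂(tripleLaw PX η ηhat) = 0 := by
  have hr : Measurable fun p : (X × L) × (X × L) => rankInd g p.1 p.2 :=
    (measurable_rankInd (A := Unit) (G := fun _ => g) (hg.comp measurable_snd)).comp
      (measurable_prodMk_left (x := ()))
  have m1 : Measurable fun v => rankInd g (fstPt a) v := hr.comp measurable_prodMk_left
  have m2 : Measurable fun u => rankInd g u (sndPt a) := hr.comp measurable_prodMk_right
  have i1 : Integrable (fun w => rankInd g (fstPt a) (sndPt w)) (tripleLaw PX η ηhat) :=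
    integrable_of_abs_le (m1.comp measurable_sndPt) fun w => abs_rankInd_le _ _ _
  have i2 : Integrable (fun w => rankInd g (fstPt w) (sndPt a)) (tripleLaw PX η ηhat) :=
    integrable_of_abs_le (m2.comp measurable_fstPt) fun w => abs_rankInd_le _ _ _
  have e1 : ∫ w, rankInd g (fstPt a) (sndPt w) ∂(tripleLaw PX η ηhat)
      = phi PX ηhat g (fstPt a) := by
    rw [phi, ← (measurePreserving_sndPt PX η ηhat).map_eq,
      integral_map measurable_sndPt.aemeasurable m1.aestronglyMeasurable]
  have e2 : ∫ w, rankInd g (fstPt w) (sndPt a) ∂(tripleLaw PX η ηhat)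
      = psi PX η g (sndPt a) := by
    rw [psi, ← (measurePreserving_fstPt PX η ηhat).map_eq,
      integral_map measurable_fstPt.aemeasurable m2.aestronglyMeasurable]
  have i3 : Integrable (fun w => rankInd g (fstPt a) (sndPt w) + rankInd g (fstPt w) (sndPt a))
    (tripleLaw PX η ηhat) := i1.add i2
  unfold projError
  rw [integral_sub i3 (integrable_const _), integral_add i1 i2, e1, e2]
  simp [proj]

/-- The variance of the projection for a fixed score. -/
noncomputable def projVar (g : X × L → ℝ) : ℝ := Var[proj PX η ηhat g; tripleLaw PX η ηhat]

variable {ι : Type*} [Fintype ι] [DecidableEq ι]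

/-- `hinv` encodes independence of the score and the fold. The centred-average bound is used for the
projection error and for the first two moments of the projection. -/
theorem lintegral_sq_foldVar_sub_projVar_le {G : (ι → X × L × L) → X × L → ℝ}
    (hG : Measurable fun p : (ι → X × L × L) × (X × L) => G p.1 p.2) {I : Finset ι}
    (hI : 2 ≤ I.card) (hinv : ∀ z, ∀ l ∈ I, ∀ w, G (Function.update z l w) = G z) :
    ∫⁻ z, ENNReal.ofReal ((foldVar (G z) z I - projVar PX η ηhat (G z)) ^ 2)
        ∂(Measure.pi fun _ => tripleLaw PX η ηhat) ≤ ENNReal.ofReal (5632 / (I.card : ℝ)) := by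
  set P := tripleLaw PX η ηhat with hP
  set N : Measure (ι → X × L × L) := Measure.pi fun _ => P with hN
  have hI0 : 0 < I.card := by omega
  have hm0 : (0 : ℝ) < I.card := by exact_mod_cast hI0
  -- Only fills the slot for the first triplet in `t2` and `t3`, where the centred variable ignores
  -- it.
  obtain ⟨i₀, -⟩ := Finset.card_pos.1 hI0
  have hp := measurable_proj PX η ηhat hG
  have hGz : ∀ z, Measurable (G z) := fun z => hG.comp measurable_prodMk_left
  have hpz : ∀ z, Measurable (proj PX η ηhat (G z)) := fun z => hp.comp measurable_prodMk_left
  have hM₁ : Measurable fun z => ∫ w, proj PX η ηhat (G z) w ∂P :=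
    hp.stronglyMeasurable.integral_prod_right'.measurable
  have hM₂ : Measurable fun z => ∫ w, proj PX η ηhat (G z) w ^ 2 ∂P :=
    (hp.pow_const 2).stronglyMeasurable.integral_prod_right'.measurable
  have bp : ∀ g w, |proj PX η ηhat g w| ≤ 2 := abs_proj_le PX η ηhat
  have bp2 : ∀ g w, proj PX η ηhat g w ^ 2 ∈ Set.Icc (0 : ℝ) 4 := fun g w =>
    ⟨sq_nonneg _, by
      have h := pow_le_pow_left₀ (abs_nonneg _) (bp g w) 2
      rw [sq_abs] at h; linarith⟩
  have bp2' : ∀ g w, |proj PX η ηhat g w ^ 2| ≤ 4 := fun g w => by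
    rw [abs_of_nonneg (bp2 g w).1]; exact (bp2 g w).2
  have bM₁ : ∀ z, ∫ w, proj PX η ηhat (G z) w ∂P ∈ Set.Icc (0 : ℝ) 2 := fun z =>
    ⟨integral_nonneg fun w => (proj_mem_Icc PX η ηhat _ w).1,
      (abs_le.1 (abs_integral_le_of_abs_le (bp (G z)))).2⟩
  have bM₂ : ∀ z, ∫ w, proj PX η ηhat (G z) w ^ 2 ∂P ∈ Set.Icc (0 : ℝ) 4 := fun z =>
    ⟨integral_nonneg fun w => (bp2 _ w).1,
      (abs_le.1 (abs_integral_le_of_abs_le (bp2' (G z)))).2⟩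
  have t1 : ∀ i, ∫ z, (1 / (I.card : ℝ) * ∑ j ∈ I, projError (G z) PX η ηhat (z i) (z j)) ^ 2 ∂N
      ≤ 2 ^ 2 / (I.card : ℝ) := fun i =>
    integral_sq_average_le_of_centered (ξ := fun z a w => projError (G z) PX η ηhat a w)
      (measurable_projError PX η ηhat hG) (fun z a w => abs_projError_le PX η ηhat _ a w)
      (fun z l hl w => by simp only [hinv z l hl w])
      (fun z a => integral_projError PX η ηhat (hGz z) a) hI0 i
  have t2 : ∫ z, (1 / (I.card : ℝ) * ∑ j ∈ I, (proj PX η ηhat (G z) (z j) ^ 2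
      - ∫ w, proj PX η ηhat (G z) w ^ 2 ∂P)) ^ 2 ∂N ≤ 4 ^ 2 / (I.card : ℝ) := by
    refine integral_sq_average_le_of_centered (ξ := fun z _ b => proj PX η ηhat (G z) b ^ 2
      - ∫ w, proj PX η ηhat (G z) w ^ 2 ∂P) ?_ ?_ ?_ ?_ hI0 i₀
    · exact ((hp.comp (measurable_fst.prodMk measurable_snd.snd)).pow_const 2).sub
        (hM₂.comp measurable_fst)
    · intro z _ b
      rw [abs_le]
      constructor <;> linarith [(bp2 (G z) b).1, (bp2 (G z) b).2, (bM₂ z).1, (bM₂ z).2]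
    · intro z l hl w
      simp only [hinv z l hl w]
    · intro z _
      rw [integral_sub (integrable_of_abs_le ((hpz z).pow_const 2) (bp2' _)) (integrable_const _)]
      simp
  have t3 : ∫ z, (1 / (I.card : ℝ) * ∑ j ∈ I, (proj PX η ηhat (G z) (z j)
      - ∫ w, proj PX η ηhat (G z) w ∂P)) ^ 2 ∂N ≤ 2 ^ 2 / (I.card : ℝ) := by
    refine integral_sq_average_le_of_centered (ξ := fun z _ b => proj PX η ηhat (G z) b
      - ∫ w, proj PX η ηhat (G z) w ∂P) ?_ ?_ ?_ ?_ hI0 i₀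
    · exact (hp.comp (measurable_fst.prodMk measurable_snd.snd)).sub (hM₁.comp measurable_fst)
    · intro z _ b
      have := proj_mem_Icc PX η ηhat (G z) b
      rw [abs_le]
      constructor <;> linarith [this.1, this.2, (bM₁ z).1, (bM₁ z).2]
    · intro z l hl w
      simp only [hinv z l hl w]
    · intro z _
      rw [integral_sub (integrable_of_abs_le (hpz z) (bp _)) (integrable_const _)]
      simp
  have key : ∀ z, (foldVar (G z) z I - projVar PX η ηhat (G z)) ^ 2
      ≤ 1024 * (1 / (I.card : ℝ) * ∑ i ∈ I,
          (1 / (I.card : ℝ) * ∑ j ∈ I, projError (G z) PX η ηhat (z i) (z j)) ^ 2)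
        + 16 * (1 / (I.card : ℝ) * ∑ j ∈ I, (proj PX η ηhat (G z) (z j) ^ 2
          - ∫ w, proj PX η ηhat (G z) w ^ 2 ∂P)) ^ 2
        + 256 * (1 / (I.card : ℝ) * ∑ j ∈ I, (proj PX η ηhat (G z) (z j)
          - ∫ w, proj PX η ηhat (G z) w ∂P)) ^ 2 + 256 / (I.card : ℝ) := by
    intro z
    have hvar : projVar PX η ηhat (G z) = ∫ w, proj PX η ηhat (G z) w ^ 2 ∂P
        - (∫ w, proj PX η ηhat (G z) w ∂P) ^ 2 := variance_eq_of_abs_le (hpz z) (bp _)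
    have hv0 : 0 ≤ projVar PX η ηhat (G z) := variance_nonneg _ _
    rw [hvar] at hv0 ⊢
    simp_rw [← empPhi_add_empPsi_sub_proj (G z) z I PX η ηhat hI0]
    rw [foldVar, ← average_empPhi_add_empPsi]
    refine sq_sampleVariance_sub_le I hI
      (fun i => empPhi (G z) z I (fstPt (z i)) + empPsi (G z) z I (sndPt (z i)))
      (fun i => proj PX η ηhat (G z) (z i)) (fun i _ => ?_) (fun i _ => proj_mem_Icc _ _ _ _ _)
      (bM₁ z) ⟨hv0, by nlinarith [(bM₂ z).2]⟩
    have h1 : empPhi (G z) z I (fstPt (z i)) ∈ Set.Icc (0 : ℝ) 1 :=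
      average_mem_Icc I hI0 fun j _ => ⟨rankInd_nonneg _ _ _, rankInd_le_one _ _ _⟩
    have h2 : empPsi (G z) z I (sndPt (z i)) ∈ Set.Icc (0 : ℝ) 1 :=
      average_mem_Icc I hI0 fun j _ => ⟨rankInd_nonneg _ _ _, rankInd_le_one _ _ _⟩
    exact ⟨add_nonneg h1.1 h2.1, by linarith [h1.2, h2.2]⟩
  have sqi : ∀ {f : (ι → X × L × L) → ι → ℝ} {c : ℝ}, (∀ j, Measurable fun z => f z j) →
      (∀ z j, |f z j| ≤ c) →
      Integrable (fun z => (1 / (I.card : ℝ) * ∑ j ∈ I, f z j) ^ 2) N := by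
    intro f c hf hc
    refine integrable_of_abs_le
      (((Finset.measurable_sum _ fun j _ => hf j).const_mul _).pow_const 2) (C := c ^ 2) fun z => ?_
    rw [abs_pow]
    refine pow_le_pow_left₀ (abs_nonneg _) ?_ 2
    rw [abs_mul, abs_of_pos (by positivity), one_div, inv_mul_le_iff₀ hm0]
    refine (Finset.abs_sum_le_sum_abs _ _).trans ?_
    simpa using Finset.sum_le_card_nsmul I (fun j => |f z j|) c fun j _ => hc z j
  have hpj : ∀ j, Measurable fun z => proj PX η ηhat (G z) (z j) := fun j =>
    hp.comp (measurable_id.prodMk (measurable_pi_apply j))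
  have i1 : ∀ i, Integrable (fun z =>
      (1 / (I.card : ℝ) * ∑ j ∈ I, projError (G z) PX η ηhat (z i) (z j)) ^ 2) N := fun i =>
    sqi (fun j => (measurable_projError PX η ηhat hG).comp
      (measurable_id.prodMk ((measurable_pi_apply i).prodMk (measurable_pi_apply j))))
      fun z j => abs_projError_le PX η ηhat _ _ _
  have i2 : Integrable (fun z => (1 / (I.card : ℝ) * ∑ j ∈ I, (proj PX η ηhat (G z) (z j) ^ 2
      - ∫ w, proj PX η ηhat (G z) w ^ 2 ∂P)) ^ 2) N :=
    sqi (c := 4) (fun j => ((hpj j).pow_const 2).sub hM₂) fun z j => by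
      rw [abs_le]
      constructor <;> linarith [(bp2 (G z) (z j)).1, (bp2 (G z) (z j)).2, (bM₂ z).1, (bM₂ z).2]
  have i3 : Integrable (fun z => (1 / (I.card : ℝ) * ∑ j ∈ I, (proj PX η ηhat (G z) (z j)
      - ∫ w, proj PX η ηhat (G z) w ∂P)) ^ 2) N :=
    sqi (c := 2) (fun j => (hpj j).sub hM₁) fun z j => by
      have := proj_mem_Icc PX η ηhat (G z) (z j)
      rw [abs_le]
      constructor <;> linarith [this.1, this.2, (bM₁ z).1, (bM₁ z).2]
  have i1s : Integrable (fun z => 1024 * (1 / (I.card : ℝ) * ∑ i ∈ I,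
      (1 / (I.card : ℝ) * ∑ j ∈ I, projError (G z) PX η ηhat (z i) (z j)) ^ 2)) N :=
    ((integrable_finsetSum _ fun i _ => i1 i).const_mul _).const_mul _
  have i2s := i2.const_mul 16
  have i3s := i3.const_mul 256
  have i12 := i1s.add i2s
  have i123 := i12.add i3s
  have i1234 := i123.add (integrable_const (256 / (I.card : ℝ)))
  simp only [Pi.add_def] at i12 i123 i1234
  refine (lintegral_mono fun z => ENNReal.ofReal_le_ofReal (key z)).trans ?_
  rw [← ofReal_integral_eq_lintegral_ofReal i1234
    (ae_of_all _ fun z => (sq_nonneg _).trans (key z))]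
  refine ENNReal.ofReal_le_ofReal ?_
  rw [integral_add i123 (integrable_const _), integral_add i12 i3s, integral_add i1s i2s,
    integral_const_mul, integral_const_mul, integral_const_mul, integral_const_mul,
    integral_finsetSum _ fun i _ => i1 i]
  have hsum : 1 / (I.card : ℝ) * ∑ i ∈ I, ∫ z,
      (1 / (I.card : ℝ) * ∑ j ∈ I, projError (G z) PX η ηhat (z i) (z j)) ^ 2 ∂N
      ≤ 2 ^ 2 / (I.card : ℝ) := by
    rw [one_div, inv_mul_le_iff₀ hm0]
    simpa using Finset.sum_le_card_nsmul I _ _ fun i _ => t1 i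
  simp only [integral_const, probReal_univ, one_smul]
  -- The bounds on the centred variables are 2, 4 and 2; the total is 4096 + 256 + 1024 + 256.
  calc _ ≤ 1024 * (2 ^ 2 / (I.card : ℝ)) + 16 * (4 ^ 2 / (I.card : ℝ))
        + 256 * (2 ^ 2 / (I.card : ℝ)) + 256 / (I.card : ℝ) := by gcongr
    _ = 5632 / I.card := by ring

theorem measurable_projVar {A : Type*} [MeasurableSpace A] {G : A → X × L → ℝ}
    (hG : Measurable fun p : A × (X × L) => G p.1 p.2) :
    Measurable fun a => projVar PX η ηhat (G a) := by
  have hp := measurable_proj PX η ηhat hG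
  have e : ∀ a, projVar PX η ηhat (G a) = ∫ w, proj PX η ηhat (G a) w ^ 2 ∂(tripleLaw PX η ηhat)
      - (∫ w, proj PX η ηhat (G a) w ∂(tripleLaw PX η ηhat)) ^ 2 := fun a =>
    variance_eq_of_abs_le (hp.comp measurable_prodMk_left) (abs_proj_le PX η ηhat _)
  simp_rw [e]
  exact (hp.pow_const 2).stronglyMeasurable.integral_prod_right'.measurable.sub
    (hp.stronglyMeasurable.integral_prod_right'.measurable.pow_const 2)

end FoldMoments

theorem measurable_foldVar {X L ι : Type*} [MeasurableSpace X] [MeasurableSpace L] [Fintype ι]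
    {G : (ι → X × L × L) → X × L → ℝ}
    (hG : Measurable fun p : (ι → X × L × L) × (X × L) => G p.1 p.2) (I : Finset ι) :
    Measurable fun z => foldVar (G z) z I := by
  have hr : ∀ i j, Measurable fun z : ι → X × L × L =>
      rankInd (G z) (fstPt (z i)) (sndPt (z j)) := fun i j =>
    (measurable_rankInd hG).comp (measurable_id.prodMk
      ((measurable_fstPt.comp (measurable_pi_apply i)).prodMk
        (measurable_sndPt.comp (measurable_pi_apply j))))
  unfold foldVar empPhi empPsi foldStat
  fun_prop

/-! ### Assembling the folds -/

/-- The fitting data only read indices outside the fold; this supplies the invariance required of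
the score. -/
theorem Folds.fitData_update {K m : ℕ} {α : Type*} (F : Folds K m) (z : Fin (K * m) → α)
    (k : Fin K) {l : Fin (K * m)} (hl : l ∈ F.idx k) (w : α) :
    F.fitData (Function.update z l w) k = F.fitData z k := by
  funext j
  refine Function.update_of_ne (fun h => ?_) _ _
  have := Finset.orderEmbOfFin_mem (F.idx k)ᶜ (F.card_idx_compl k) j
  rw [h, Finset.mem_compl] at this
  exact this hl

theorem map_comp_eq_pi {Ω α κ : Type*} [MeasurableSpace Ω] [MeasurableSpace α] [Fintype κ]
    {μ : Measure Ω} [IsProbabilityMeasure μ] {P : Measure α} {Z : ℕ → Ω → α}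
    (hZmeas : ∀ i, Measurable (Z i)) (hZlaw : ∀ i, μ.map (Z i) = P) (hZindep : iIndepFun Z μ)
    {e : κ → ℕ} (he : Function.Injective e) :
    μ.map (fun ω j => Z (e j) ω) = Measure.pi fun _ => P := by
  rw [(iIndepFun_iff_map_fun_eq_pi_map fun j => (hZmeas (e j)).aemeasurable).1
    (hZindep.precomp he)]
  simp_rw [hZlaw]

theorem measurable_crossVarEst {X L : Type*} [MeasurableSpace X] [MeasurableSpace L]
    {K m : ℕ} {Dhat : Distinguisher X L}
    (hD : ∀ n, Measurable fun p : (Fin n → X × L × L) × (X × L) => Dhat n p.1 p.2)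
    (F : Folds K m) : Measurable (crossVarEst Dhat F) := by
  refine Measurable.const_mul (Finset.measurable_sum _ fun k _ => ?_) _
  refine measurable_foldVar
    (G := fun z => Dhat ((K - 1) * m) (F.fitData z k)) ?_ (F.idx k)
  have hfit : Measurable fun z : Fin (K * m) → X × L × L => F.fitData z k :=
    measurable_pi_lambda _ fun j => measurable_pi_apply _
  exact (hD _).comp ((hfit.comp measurable_fst).prodMk measurable_snd)

/-! ### Mean-square error of the cross-fit estimator -/

section Consistency

variable {X L : Type*} [MeasurableSpace X] [Fintype L] [MeasurableSpace L]
  (PX : Measure X) [IsProbabilityMeasure PX] (η ηhat : Classifier X L)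

/-- `sigmaSq` is by definition the variance of `meanProj`, so the comparison of variances applies
for each fixed data set; 64 = (4 · 2)² since projections are bounded by 2. -/
theorem lintegral_sq_projVar_sub_sigmaSq_le {Dhat : Distinguisher X L} {n : ℕ}
    (hD : Measurable fun p : (Fin n → X × L × L) × (X × L) => Dhat n p.1 p.2) :
    ∫⁻ D, ENNReal.ofReal ((projVar PX η ηhat (Dhat n D) - sigmaSq PX η ηhat Dhat n) ^ 2)
        ∂(Measure.pi fun _ => tripleLaw PX η ηhat)
      ≤ 64 * ∫⁻ z, ∫⁻ D,
        ENNReal.ofReal ((proj PX η ηhat (Dhat n D) z - meanProj PX η ηhat Dhat n z) ^ 2)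
        ∂(Measure.pi fun _ => tripleLaw PX η ηhat) ∂(tripleLaw PX η ηhat) := by
  have hp := measurable_proj PX η ηhat hD
  have hmean : Measurable (meanProj PX η ηhat Dhat n) :=
    hp.stronglyMeasurable.integral_prod_left'.measurable
  have bmean : ∀ z, |meanProj PX η ηhat Dhat n z| ≤ 2 := fun z =>
    abs_integral_le_of_abs_le fun D => abs_proj_le PX η ηhat _ z
  have hsq : Measurable fun p : (Fin n → X × L × L) × (X × L × L) =>
      (proj PX η ηhat (Dhat n p.1) p.2 - meanProj PX η ηhat Dhat n p.2) ^ 2 :=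
    (hp.sub (hmean.comp measurable_snd)).pow_const 2
  have hpt : ∀ D,
      ENNReal.ofReal ((projVar PX η ηhat (Dhat n D) - sigmaSq PX η ηhat Dhat n) ^ 2)
        ≤ 64 * ∫⁻ z, ENNReal.ofReal
          ((proj PX η ηhat (Dhat n D) z - meanProj PX η ηhat Dhat n z) ^ 2)
          ∂(tripleLaw PX η ηhat) := by
    intro D
    have h := sq_variance_sub_le (μ := tripleLaw PX η ηhat) (f := proj PX η ηhat (Dhat n D))
      (hp.comp (measurable_prodMk_left (x := D))) hmean (abs_proj_le PX η ηhat (Dhat n D)) bmean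
    refine (ENNReal.ofReal_le_ofReal h).trans (le_of_eq ?_)
    rw [ENNReal.ofReal_mul (by positivity), ofReal_integral_eq_lintegral_ofReal
      (integrable_of_abs_le
        (f := fun z => (proj PX η ηhat (Dhat n D) z - meanProj PX η ηhat Dhat n z) ^ 2)
        (hsq.comp (measurable_prodMk_left (x := D))) (C := 4 ^ 2) fun z => by
        rw [abs_pow]
        exact pow_le_pow_left₀ (abs_nonneg _) ((abs_sub _ _).trans
          (by linarith [abs_proj_le PX η ηhat (Dhat n D) z, bmean z])) 2)
      (ae_of_all _ fun z => sq_nonneg _)]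
    norm_num
  refine (lintegral_mono hpt).trans (le_of_eq ?_)
  rw [lintegral_const_mul' _ _ (by norm_num)]
  congr 1
  exact (lintegral_prod _ hsq.ennreal_ofReal.aemeasurable).symm.trans
    (lintegral_prod_symm _ hsq.ennreal_ofReal.aemeasurable)

/-- Deliberately crude: the square of the average is bounded by the sum of squares, which is
harmless for fixed `K`. Dependence between folds plays no role. -/
theorem ofReal_sq_average_sub_le {K : ℕ} (hK : 0 < K) (a b : Fin K → ℝ) (c : ℝ) :
    ENNReal.ofReal ((1 / (K : ℝ) * ∑ k, a k - c) ^ 2)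
      ≤ ∑ k, 2 * (ENNReal.ofReal ((a k - b k) ^ 2) + ENNReal.ofReal ((b k - c) ^ 2)) := by
  have hK0 : (0 : ℝ) < K := by exact_mod_cast hK
  have hK1 : (1 : ℝ) ≤ K := by exact_mod_cast hK
  have e : 1 / (K : ℝ) * ∑ k, a k - c = 1 / (K : ℝ) * ∑ k, (a k - c) := by
    rw [Finset.sum_sub_distrib, Finset.sum_const, Finset.card_univ, Fintype.card_fin,
      nsmul_eq_mul]
    field_simp
  have h1 : (1 / (K : ℝ) * ∑ k, (a k - c)) ^ 2 ≤ ∑ k, (a k - c) ^ 2 := by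
    have h2 := sq_sum_le_card_mul_sum_sq (s := Finset.univ) (f := fun k : Fin K => a k - c)
    rw [Finset.card_univ, Fintype.card_fin] at h2
    have h3 : 0 ≤ ∑ k, (a k - c) ^ 2 := Finset.sum_nonneg fun k _ => sq_nonneg _
    rw [mul_pow, div_pow, one_pow, one_div, inv_mul_le_iff₀ (by positivity)]
    nlinarith [mul_nonneg (mul_nonneg hK0.le (sub_nonneg.2 hK1)) h3]
  rw [e]
  refine (ENNReal.ofReal_le_ofReal h1).trans ?_
  rw [ENNReal.ofReal_sum_of_nonneg fun k _ => sq_nonneg _]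
  refine Finset.sum_le_sum fun k _ => ?_
  rw [show a k - c = (a k - b k) + (b k - c) by ring]
  exact ofReal_add_sq_le _ _

theorem lintegral_sq_crossVarEst_sub_sigmaSq_le {Ω : Type*} [MeasurableSpace Ω]
    (μ : Measure Ω) {K m : ℕ} (hK : 0 < K) (hm : 2 ≤ m)
    {Dhat : Distinguisher X L}
    (hD : ∀ n, Measurable fun p : (Fin n → X × L × L) × (X × L) => Dhat n p.1 p.2)
    (F : Folds K m) {Y : Ω → Fin (K * m) → X × L × L} (hY : Measurable Y)
    (hlaw : μ.map Y = Measure.pi fun _ => tripleLaw PX η ηhat)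
    (hfit : ∀ k, μ.map (fun ω => F.fitData (Y ω) k) = Measure.pi fun _ => tripleLaw PX η ηhat) :
    ∫⁻ ω, ENNReal.ofReal ((crossVarEst Dhat F (Y ω)
        - sigmaSq PX η ηhat Dhat ((K - 1) * m)) ^ 2) ∂μ
      ≤ K * (2 * (ENNReal.ofReal (5632 / m) + 64 * ∫⁻ z, ∫⁻ D,
        ENNReal.ofReal ((proj PX η ηhat (Dhat ((K - 1) * m) D) z
          - meanProj PX η ηhat Dhat ((K - 1) * m) z) ^ 2)
        ∂(Measure.pi fun _ => tripleLaw PX η ηhat) ∂(tripleLaw PX η ηhat))) := by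
  set n := (K - 1) * m with hn
  set P := tripleLaw PX η ηhat with hP
  set N : Measure (Fin (K * m) → X × L × L) := Measure.pi fun _ => P with hN
  have hfitm : ∀ k, Measurable fun z : Fin (K * m) → X × L × L => F.fitData z k := fun k =>
    measurable_pi_lambda _ fun j => measurable_pi_apply _
  have hG : ∀ k, Measurable fun p : (Fin (K * m) → X × L × L) × (X × L) =>
      Dhat n (F.fitData p.1 k) p.2 := fun k =>
    (hD n).comp (((hfitm k).comp measurable_fst).prodMk measurable_snd)
  have hcard : ∀ k, (F.idx k).card = m := F.card_fold
  have hfv : ∀ k, Measurable fun z => foldVar (Dhat n (F.fitData z k)) z (F.idx k) := fun k =>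
    measurable_foldVar (hG k) _
  have hpv : ∀ k, Measurable fun z : Fin (K * m) → X × L × L =>
      projVar PX η ηhat (Dhat n (F.fitData z k)) := fun k => measurable_projVar PX η ηhat (hG k)
  have hd1 : ∀ k, Measurable fun z => ENNReal.ofReal
      ((foldVar (Dhat n (F.fitData z k)) z (F.idx k)
        - projVar PX η ηhat (Dhat n (F.fitData z k))) ^ 2) := fun k =>
    (((hfv k).sub (hpv k)).pow_const 2).ennreal_ofReal
  have hd2 : ∀ k, Measurable fun z : Fin (K * m) → X × L × L => ENNReal.ofReal
      ((projVar PX η ηhat (Dhat n (F.fitData z k)) - sigmaSq PX η ηhat Dhat n) ^ 2) := fun k =>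
    (((hpv k).sub_const _).pow_const 2).ennreal_ofReal
  have h1 : ∀ k, ∫⁻ ω, ENNReal.ofReal
      ((foldVar (Dhat n (F.fitData (Y ω) k)) (Y ω) (F.idx k)
        - projVar PX η ηhat (Dhat n (F.fitData (Y ω) k))) ^ 2) ∂μ
      ≤ ENNReal.ofReal (5632 / m) := by
    intro k
    have h := lintegral_sq_foldVar_sub_projVar_le PX η ηhat
      (G := fun z => Dhat n (F.fitData z k)) (hG k) (I := F.idx k)
      (by rw [hcard]; exact hm) fun z l hl w => by rw [F.fitData_update z k hl w]
    rw [hcard] at h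
    refine le_trans (le_of_eq ?_) h
    rw [← hP, ← hN, ← hlaw, lintegral_map (hd1 k) hY]
  have h2 : ∀ k, ∫⁻ ω, ENNReal.ofReal
      ((projVar PX η ηhat (Dhat n (F.fitData (Y ω) k))
        - sigmaSq PX η ηhat Dhat n) ^ 2) ∂μ
      ≤ 64 * ∫⁻ z, ∫⁻ D, ENNReal.ofReal ((proj PX η ηhat (Dhat n D) z
          - meanProj PX η ηhat Dhat n z) ^ 2) ∂(Measure.pi fun _ => P) ∂P := by
    intro k
    refine le_trans (le_of_eq ?_) (lintegral_sq_projVar_sub_sigmaSq_le PX η ηhat (hD n))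
    have hV : Measurable fun D : Fin n → X × L × L => ENNReal.ofReal
        ((projVar PX η ηhat (Dhat n D) - sigmaSq PX η ηhat Dhat n) ^ 2) :=
      (((measurable_projVar PX η ηhat (hD n)).sub_const _).pow_const 2).ennreal_ofReal
    have hFY : Measurable fun ω => F.fitData (Y ω) k := (hfitm k).comp hY
    rw [← hP, ← hfit k, lintegral_map hV hFY]
  calc ∫⁻ ω, ENNReal.ofReal ((crossVarEst Dhat F (Y ω)
        - sigmaSq PX η ηhat Dhat n) ^ 2) ∂μ
      ≤ ∫⁻ ω, ∑ k, 2 * (ENNReal.ofReal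
          ((foldVar (Dhat n (F.fitData (Y ω) k)) (Y ω) (F.idx k)
            - projVar PX η ηhat (Dhat n (F.fitData (Y ω) k))) ^ 2)
          + ENNReal.ofReal ((projVar PX η ηhat (Dhat n (F.fitData (Y ω) k))
            - sigmaSq PX η ηhat Dhat n) ^ 2)) ∂μ :=
        lintegral_mono fun ω => ofReal_sq_average_sub_le hK _ _ _
    _ = ∑ k, 2 * (∫⁻ ω, ENNReal.ofReal
          ((foldVar (Dhat n (F.fitData (Y ω) k)) (Y ω) (F.idx k)
            - projVar PX η ηhat (Dhat n (F.fitData (Y ω) k))) ^ 2) ∂μ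
          + ∫⁻ ω, ENNReal.ofReal ((projVar PX η ηhat (Dhat n (F.fitData (Y ω) k))
            - sigmaSq PX η ηhat Dhat n) ^ 2) ∂μ) := by
        refine (lintegral_finsetSum _ fun k _ =>
          (((hd1 k).comp hY).add ((hd2 k).comp hY)).const_mul 2).trans ?_
        refine Finset.sum_congr rfl fun k _ => ?_
        rw [lintegral_const_mul' _ _ (by norm_num)]
        congr 1
        exact lintegral_add_left ((hd1 k).comp hY) _
    _ ≤ ∑ k : Fin K, 2 * (ENNReal.ofReal (5632 / m) + 64 * ∫⁻ z, ∫⁻ D,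
          ENNReal.ofReal ((proj PX η ηhat (Dhat n D) z - meanProj PX η ηhat Dhat n z) ^ 2)
          ∂(Measure.pi fun _ => P) ∂P) := by
        gcongr with k
        · exact h1 k
        · exact h2 k
    _ = _ := by
        rw [Finset.sum_const, Finset.card_univ, Fintype.card_fin, nsmul_eq_mul]

end Consistency

end CrossFit

theorem mainTheorem5
    {X L Ω : Type*} [MeasurableSpace X]
    [Fintype L] [MeasurableSpace L] [MeasurableSingletonClass L]
    [MeasurableSpace Ω] (μ : Measure Ω) [IsProbabilityMeasure μ]
    (K : ℕ) (hK : 2 ≤ K)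
    (PX : Measure X) [IsProbabilityMeasure PX]
    (η ηhat : CrossFit.Classifier X L)
    (Dhat : CrossFit.Distinguisher X L)
    (hDhat : ∀ n, Measurable fun p : (Fin n → X × L × L) × (X × L) => Dhat n p.1 p.2)
    (hA : CrossFit.Assumption K PX η ηhat Dhat)
    (Z : ℕ → Ω → X × L × L)
    (hZmeas : ∀ i, Measurable (Z i))
    (hZlaw : ∀ i, μ.map (Z i) = CrossFit.tripleLaw PX η ηhat)
    (hZindep : iIndepFun Z μ)
    (F : ∀ m, CrossFit.Folds K m) :
    TendstoInMeasure μ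
      (fun (m : ℕ) (ω : Ω) =>
        CrossFit.crossVarEst Dhat (F m) (fun i => Z i ω) /
          CrossFit.sigmaSq PX η ηhat Dhat ((K - 1) * m))
      atTop (fun _ => 1) := by
  obtain ⟨c, hc, hσ⟩ := hA.variance_pos
  have hn : Tendsto (fun m => (K - 1) * m) atTop atTop :=
    tendsto_id.const_mul_atTop' (by omega)
  have hproj := (CrossFit.tendsto_lintegral_sq_proj_sub_meanProj PX η ηhat hDhat hA).comp hn
  have hinv : Tendsto (fun m : ℕ => ENNReal.ofReal (5632 / m)) atTop (nhds 0) := by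
    simpa using ENNReal.tendsto_ofReal (tendsto_const_div_atTop_nhds_zero_nat (5632 : ℝ))
  have hbound := ENNReal.Tendsto.const_mul (a := (K : ℝ≥0∞)) (ENNReal.Tendsto.const_mul
    (a := 2) (hinv.add (ENNReal.Tendsto.const_mul (a := 64) hproj (Or.inr (by norm_num))))
    (Or.inr (by norm_num))) (Or.inr (by finiteness))
  simp only [mul_zero, add_zero] at hbound
  have hL2 : Tendsto (fun m => ∫⁻ ω, ENNReal.ofReal
      ((CrossFit.crossVarEst Dhat (F m) (fun i => Z i ω)
        - CrossFit.sigmaSq PX η ηhat Dhat ((K - 1) * m)) ^ 2) ∂μ) atTop (nhds 0) := by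
    refine tendsto_of_tendsto_of_tendsto_of_le_of_le' tendsto_const_nhds hbound
      (Eventually.of_forall fun _ => zero_le) ?_
    -- For m = 1 the normalisation 1/(m - 1) takes the default value 0, so small folds are
    -- discarded.
    filter_upwards [eventually_ge_atTop 2] with m hm
    refine CrossFit.lintegral_sq_crossVarEst_sub_sigmaSq_le PX η ηhat μ (by omega) hm hDhat (F m)
      (measurable_pi_lambda _ fun i => hZmeas i)
      (CrossFit.map_comp_eq_pi hZmeas hZlaw hZindep Fin.val_injective) fun k => ?_
    exact CrossFit.map_comp_eq_pi hZmeas hZlaw hZindep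
      (e := fun j => ((((F m).idx k)ᶜ.orderEmbOfFin ((F m).card_idx_compl k) j :
        Fin (K * m)) : ℕ))
      (Fin.val_injective.comp (((F m).idx k)ᶜ.orderEmbOfFin ((F m).card_idx_compl k)).injective)
  rw [tendstoInMeasure_iff_dist]
  intro ε hε
  -- A relative error of at least ε means an absolute error of at least ε s ≥ ε c, so Markov's
  -- inequality is applied to the squared error at the level (ε c)², which does not depend on `m`.
  have hε0 : ENNReal.ofReal ((ε * c) ^ 2) ≠ 0 := (ENNReal.ofReal_pos.2 (by positivity)).ne'
  have hdiv := ENNReal.Tendsto.div_const hL2 (Or.inr hε0)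
  rw [ENNReal.zero_div] at hdiv
  refine tendsto_of_tendsto_of_tendsto_of_le_of_le' tendsto_const_nhds hdiv
    (Eventually.of_forall fun _ => zero_le) ?_
  filter_upwards [eventually_ge_atTop 1] with m hm
  have hσm := hσ m hm
  set s := CrossFit.sigmaSq PX η ηhat Dhat ((K - 1) * m) with hs
  have hs0 : 0 < s := hc.trans hσm
  have hmeas : Measurable fun ω => ENNReal.ofReal
      ((CrossFit.crossVarEst Dhat (F m) (fun i => Z i ω) - s) ^ 2) :=
    ((((CrossFit.measurable_crossVarEst hDhat (F m)).comp
      (measurable_pi_lambda _ fun i : Fin (K * m) => hZmeas i)).sub_const s).pow_const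
        2).ennreal_ofReal
  refine (measure_mono fun ω hω => ?_).trans
    (meas_ge_le_lintegral_div hmeas.aemeasurable hε0 ENNReal.ofReal_ne_top)
  have hω' : ε ≤ |CrossFit.crossVarEst Dhat (F m) (fun i => Z i ω) / s - 1| := hω
  refine ENNReal.ofReal_le_ofReal ?_
  rw [← sq_abs (_ - s)]
  refine pow_le_pow_left₀ (by positivity) ?_ 2
  rw [div_sub_one hs0.ne', abs_div, abs_of_pos hs0, le_div_iff₀ hs0] at hω'
  exact (mul_le_mul_of_nonneg_left hσm.le hε.le).trans hω'
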